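/- A \emph{guarded multi-energy timed automaton} (guarded META) consists of finite sets of actions, locations, clocks and energy variables; an initial location; a non-empty set of private locations; a non-empty set of final locations, which are not private and have no outgoing edges; a labelling of the locations by finite sets of atomic propositions; for each location an invariant and an integer rate for each energy variable; and finitely many edges, each with a source and a target location, a guard, an action (possibly silent), a set of clocks to be reset to $0$, and an integer offset for each energy variable. Invariants and guards are finite conjunctions of inequalities $v \bowtie d$ with $v$ a clock or an energy variable, ${\bowtie} \in \{<,\leq,\geq,>\}$ and $d \in \mathbb{Z}$. A state is a location together with non-negative real values of all clocks and energy variables that satisfy the invariant of the location. Delaying by $d \geq 0$ in a location adds $d$ to every clock and $d$ times its rate to every energy variable, and is allowed if all the intermediate triples are states. Taking an edge between two states requires its guard, resets its clocks, and adds its offsets to the energy variables. A run is a finite sequence of steps (a delay followed by an edge) from the initial state, in which all clocks and energy variables are $0$ and which is assumed to satisfy the invariant of the initial location; its duration is the sum of its delays, and its final energies are the energy values in its last state. A run that ends in a final location is \emph{private} if it visits a private location, and \emph{public} otherwise. A guarded META is \emph{discrete} if all its rates are $0$, i.e. energies change along edges only. Let $\mathrm{Priv}$ and $\mathrm{Pub}$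 be the sets of observations of the private and of the public runs, where the observation of a run is its final energies for $\sigma = \mathrm{EN}$, and the pair of its duration and its final energies for $\sigma = \mathrm{ET\text{-}EN}$. The automaton is $\exists$-$\sigma$-opaque if $\mathrm{Priv} \cap \mathrm{Pub} \neq \emptyset$, weakly $\sigma$-opaque if $\mathrm{Priv} \subseteq \mathrm{Pub}$, and fully $\sigma$-opaque if $\mathrm{Priv} = \mathrm{Pub}$. \textbf{Proposition.} For each $\delta \in \{\exists, \text{weak}, \text{full}\}$ and each $\sigma \in \{\mathrm{EN}, \mathrm{ET\text{-}EN}\}$, the following problem is undecidable: given a discrete guarded META with exactly $2$ energy variables and $1$ clock, is it $\delta$-$\sigma$-opaque? -/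

import Mathlib

/-! ### Simple constraints -/

/-- The comparison operators `<`, `≤`, `≥`, `>`. -/
inductive Cmp where
  | lt | le | ge | gt
  deriving DecidableEq

/-- `c.Holds a b` means `a ⋈ b` for the operator `⋈` named by `c`. -/
def Cmp.Holds : Cmp → ℝ → ℝ → Prop
  | .lt, a, b => a < b
  | .le, a, b => a ≤ b
  | .ge, a, b => a ≥ b
  | .gt, a, b => a > b

/-- An inequality `v ⋈ d`, where `v` is a clock or an energy variable and `d` is an integer. -/
structure Atom (Clk En : Type) where
  var : Clk ⊕ En
  cmp : Cmp
  bound : ℤ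

/-- A simple constraint: a finite conjunction of inequalities `v ⋈ d`. -/
abbrev SimpleConstraint (Clk En : Type) := List (Atom Clk En)

/-- Satisfaction of a simple constraint by a clock valuation and an energy valuation. -/
def SimpleConstraint.Sat {Clk En : Type} (g : SimpleConstraint Clk En)
    (ν : Clk → ℝ) (v : En → ℝ) : Prop :=
  ∀ a ∈ g, a.cmp.Holds (Sum.elim ν v a.var) (a.bound : ℝ)

/-! ### Guarded multi-energy timed automata -/

/-- Edges `(ℓ, g, a, R, U, ℓ')`; the action `none` is the silent action `ε`. -/
structure METAEdge (Act Loc Clk En : Type) where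
  src : Loc
  guard : SimpleConstraint Clk En
  act : Option Act
  reset : Finset Clk
  upd : En → ℤ
  tgt : Loc

/-- Guarded multi-energy timed automata with actions `Act`, locations `Loc`, atomic propositions
`AP`, clocks `Clk` and energy variables `En`. The finite set of edges is given by a list of its
elements. -/
structure GuardedMETA (Act Loc AP Clk En : Type) where
  init : Loc
  priv : Finset Loc
  final : Finset Loc
  label : Loc → Finset AP
  inv : Loc → SimpleConstraint Clk En
  rate : Loc → En → ℤ
  edges : List (METAEdge Act Loc Clk En)
  priv_nonempty : priv.Nonempty
  final_nonempty : final.Nonempty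
  final_not_priv : ∀ l ∈ final, l ∉ priv
  final_no_outgoing : ∀ e ∈ edges, e.src ∉ final
  init_inv : (inv init).Sat (fun _ => 0) (fun _ => 0)

/-- Triples (location, clock valuation, energy valuation). -/
structure METAState (Loc Clk En : Type) where
  loc : Loc
  clk : Clk → ℝ
  en : En → ℝ

namespace GuardedMETA

variable {Act Loc AP Clk En : Type}

/-- The set `S` of concrete states: all clocks and energies are non-negative and the invariant of
the location holds. -/
def IsState (A : GuardedMETA Act Loc AP Clk En) (s : METAState Loc Clk En) : Prop :=
  (∀ x, 0 ≤ s.clk x) ∧ (∀ η, 0 ≤ s.en η) ∧ (A.inv s.loc).Sat s.clk s.en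

/-- The initial state: initial location, all clocks and energies `0`. -/
def initState (A : GuardedMETA Act Loc AP Clk En) : METAState Loc Clk En where
  loc := A.init
  clk := fun _ => 0
  en := fun _ => 0

/-- The triple obtained from `s` by letting `d` time units elapse. -/
def elapse (A : GuardedMETA Act Loc AP Clk En) (s : METAState Loc Clk En) (d : ℝ) :
    METAState Loc Clk En where
  loc := s.loc
  clk := fun x => s.clk x + d
  en := fun η => s.en η + (A.rate s.loc η : ℝ) * d

/-- Delay transitions. -/
def Delay (A : GuardedMETA Act Loc AP Clk En) (s : METAState Loc Clk En) (d : ℝ)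
    (t : METAState Loc Clk En) : Prop :=
  0 ≤ d ∧ t = A.elapse s d ∧ ∀ d', 0 ≤ d' → d' ≤ d → A.IsState (A.elapse s d')

/-- Discrete transitions. -/
def Fire (A : GuardedMETA Act Loc AP Clk En) (s : METAState Loc Clk En)
    (e : METAEdge Act Loc Clk En) (t : METAState Loc Clk En) : Prop :=
  A.IsState s ∧ A.IsState t ∧ e ∈ A.edges ∧ s.loc = e.src ∧ t.loc = e.tgt ∧
    (∀ x, (x ∈ e.reset → t.clk x = 0) ∧ (x ∉ e.reset → t.clk x = s.clk x)) ∧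
    (∀ η, t.en η = s.en η + (e.upd η : ℝ)) ∧
    e.guard.Sat s.clk s.en

/-- A delay followed by a discrete transition. -/
def Step (A : GuardedMETA Act Loc AP Clk En) (s : METAState Loc Clk En) (d : ℝ)
    (e : METAEdge Act Loc Clk En) (t : METAState Loc Clk En) : Prop :=
  ∃ s', A.Delay s d s' ∧ A.Fire s' e t

/-- Concrete runs; `Run A s` is the type of the runs of `A` from the initial state to `s`. -/
inductive Run (A : GuardedMETA Act Loc AP Clk En) : METAState Loc Clk En → Type
  | start : Run A A.initState
  | step {s t : METAState Loc Clk En} (r : Run A s) (d : ℝ) (e : METAEdge Act Loc Clk En)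
      (h : A.Step s d e t) : Run A t

/-- The duration of a run: the sum of its delays. -/
def Run.duration {A : GuardedMETA Act Loc AP Clk En} {s : METAState Loc Clk En} : A.Run s → ℝ
  | .start => 0
  | .step r d _ _ => r.duration + d

/-- `r.Visits L`: some state that belongs to the run has its location in `L`. -/
def Run.Visits {A : GuardedMETA Act Loc AP Clk En} {s : METAState Loc Clk En} (L : Finset Loc) :
    A.Run s → Prop
  | .start => A.init ∈ L
  | .step (t := t) r _ _ _ => r.Visits L ∨ t.loc ∈ L

/-- Private runs: they end in a final location and visit a private location. -/
def Run.IsPrivate {A : GuardedMETA Act Loc AP Clk En} {s : METAState Loc Clk En}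
    (r : A.Run s) : Prop :=
  s.loc ∈ A.final ∧ r.Visits A.priv

/-- Public runs: they end in a final location and visit no private location. -/
def Run.IsPublic {A : GuardedMETA Act Loc AP Clk En} {s : METAState Loc Clk En}
    (r : A.Run s) : Prop :=
  s.loc ∈ A.final ∧ ¬ r.Visits A.priv

/-- The final energies of the private runs. -/
def privEnergies (A : GuardedMETA Act Loc AP Clk En) : Set (En → ℝ) :=
  {v | ∃ (s : METAState Loc Clk En) (r : A.Run s), r.IsPrivate ∧ s.en = v}

/-- The final energies of the public runs. -/
def pubEnergies (A : GuardedMETA Act Loc AP Clk En) : Set (En → ℝ) :=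
  {v | ∃ (s : METAState Loc Clk En) (r : A.Run s), r.IsPublic ∧ s.en = v}

/-- The pairs (duration, final energies) of the private runs. -/
def privDurEnergies (A : GuardedMETA Act Loc AP Clk En) : Set (ℝ × (En → ℝ)) :=
  {p | ∃ (s : METAState Loc Clk En) (r : A.Run s),
    r.IsPrivate ∧ r.duration = p.1 ∧ s.en = p.2}

/-- The pairs (duration, final energies) of the public runs. -/
def pubDurEnergies (A : GuardedMETA Act Loc AP Clk En) : Set (ℝ × (En → ℝ)) :=
  {p | ∃ (s : METAState Loc Clk En) (r : A.Run s),
    r.IsPublic ∧ r.duration = p.1 ∧ s.en = p.2}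

/-- A guarded META is discrete if energies change along edges only, i.e. all rates are `0`. -/
def IsDiscrete (A : GuardedMETA Act Loc AP Clk En) : Prop :=
  ∀ l η, A.rate l η = 0

end GuardedMETA

/-! ### Opacity -/

/-- The three notions of opacity: `∃`, weak, full. -/
inductive OpacityKind where
  | exist | weak | full

/-- What is observed: the final energies (`EN`), or the duration of the run together with the
final energies (`ETEN`). -/
inductive Observation where
  | EN | ETEN

/-- The comparison of the private with the public observations. -/
def OpacityKind.Rel {α : Type} : OpacityKind → Set α → Set α → Prop
  | .exist, P, Q => (P ∩ Q).Nonempty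
  | .weak, P, Q => P ⊆ Q
  | .full, P, Q => P = Q

/-- `δ`-`σ`-opacity. -/
def GuardedMETA.Opaque {Act Loc AP Clk En : Type} (A : GuardedMETA Act Loc AP Clk En)
    (δ : OpacityKind) : Observation → Prop
  | .EN => δ.Rel A.privEnergies A.pubEnergies
  | .ETEN => δ.Rel A.privDurEnergies A.pubDurEnergies

/-! ### Guarded METAs as inputs of algorithms -/

/-- Guarded METAs with actions `0, …, k-1`, locations `0, …, n-1`, clocks `0, …, x-1`, energy
variables `0, …, m-1`, and natural numbers as names of atomic propositions. Up to renaming, these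
are all guarded METAs. -/
abbrev FinMETA (k n x m : ℕ) := GuardedMETA (Fin k) (Fin n) ℕ (Fin x) (Fin m)

/-- (clock or energy variable, operator, constant) -/
abbrev AtomCode := (ℕ ⊕ ℕ) × ℕ × ℤ

abbrev ConstraintCode := List AtomCode

/-- (source, guard, action, reset clocks, energy updates, target) -/
abbrev EdgeCode := ℕ × ConstraintCode × Option ℕ × List ℕ × List ℤ × ℕ

/-- (number of actions, of locations, of clocks, of energy variables, initial location,
private locations, final locations, labels, invariants, rates, edges), where a function on
locations or on energy variables is given by the list of its values. -/
abbrev METACode := ℕ × ℕ × ℕ × ℕ × ℕ × List ℕ × List ℕ × List (List ℕ) × List ConstraintCode ×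
  List (List ℤ) × List EdgeCode

def Cmp.code : Cmp → ℕ
  | .lt => 0
  | .le => 1
  | .ge => 2
  | .gt => 3

def Atom.code {x m : ℕ} (a : Atom (Fin x) (Fin m)) : AtomCode :=
  (a.var.map Fin.val Fin.val, a.cmp.code, a.bound)

def SimpleConstraint.code {x m : ℕ} (g : SimpleConstraint (Fin x) (Fin m)) : ConstraintCode :=
  g.map Atom.code

/-- The increasing list of the elements of a finite set. -/
def finsetCode {n : ℕ} (s : Finset (Fin n)) : List ℕ :=
  (s.sort (· ≤ ·)).map Fin.val

def METAEdge.code {k n x m : ℕ} (e : METAEdge (Fin k) (Fin n) (Fin x) (Fin m)) : EdgeCode :=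
  (e.src.val, e.guard.code, e.act.map Fin.val, finsetCode e.reset, List.ofFn e.upd, e.tgt.val)

/-- The finite word that describes a guarded META to an algorithm. -/
def GuardedMETA.code {k n x m : ℕ} (A : FinMETA k n x m) : METACode :=
  (k, n, x, m, A.init.val, finsetCode A.priv, finsetCode A.final,
    List.ofFn (fun l => (A.label l).sort (· ≤ ·)), List.ofFn (fun l => (A.inv l).code),
    List.ofFn (fun l => List.ofFn (A.rate l)), A.edges.map METAEdge.code)

/-- The property `P` is decidable on the class `C` of guarded METAs: some algorithm, given the
description of any member `A` of `C`, halts and answers whether `P A` holds. Nothing is required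
of the algorithm on other inputs. -/
def DecidableOnMETAs (C P : ∀ ⦃k n x m : ℕ⦄, FinMETA k n x m → Prop) : Prop :=
  ∃ f : METACode →. Bool, Partrec f ∧
    ∀ ⦃k n x m : ℕ⦄ (A : FinMETA k n x m), C A → ∃ b ∈ f A.code, (b = true ↔ P A)

/-! ### The description of a guarded META determines it -/

theorem Cmp.code_injective : Function.Injective Cmp.code := by
  intro a b h
  cases a <;> cases b <;> simp_all [Cmp.code]

theorem Atom.code_injective {x m : ℕ} :
    Function.Injective (Atom.code : Atom (Fin x) (Fin m) → AtomCode) := by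
  rintro ⟨v, c, d⟩ ⟨v', c', d'⟩ h
  simp only [Atom.code, Prod.mk.injEq] at h
  obtain ⟨h1, h2, h3⟩ := h
  have h1 := Function.Injective.sumMap Fin.val_injective Fin.val_injective h1
  have h2 := Cmp.code_injective h2
  subst h1 h2 h3
  rfl

theorem SimpleConstraint.code_injective {x m : ℕ} :
    Function.Injective (SimpleConstraint.code : SimpleConstraint (Fin x) (Fin m) → _) :=
  List.map_injective_iff.2 Atom.code_injective

theorem finsetCode_injective {n : ℕ} :
    Function.Injective (finsetCode : Finset (Fin n) → List ℕ) := by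
  intro s t h
  have h := List.map_injective_iff.2 Fin.val_injective h
  rw [← Finset.sort_toFinset s (· ≤ ·), h, Finset.sort_toFinset]

theorem METAEdge.code_injective {k n x m : ℕ} :
    Function.Injective (METAEdge.code : METAEdge (Fin k) (Fin n) (Fin x) (Fin m) → EdgeCode) := by
  rintro ⟨s, g, a, r, u, t⟩ ⟨s', g', a', r', u', t'⟩ h
  simp only [METAEdge.code, Prod.mk.injEq] at h
  obtain ⟨h1, h2, h3, h4, h5, h6⟩ := h
  have h1 := Fin.val_injective h1
  have h2 := SimpleConstraint.code_injective h2
  have h3 := Option.map_injective Fin.val_injective h3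
  have h4 := finsetCode_injective h4
  have h5 := List.ofFn_injective h5
  have h6 := Fin.val_injective h6
  subst h1 h2 h3 h4 h5 h6
  rfl

theorem GuardedMETA.code_injective {k n x m : ℕ} :
    Function.Injective (GuardedMETA.code : FinMETA k n x m → METACode) := by
  rintro ⟨i, p, f, l, v, r, e, _, _, _, _, _⟩ ⟨i', p', f', l', v', r', e', _, _, _, _, _⟩ h
  simp only [GuardedMETA.code, Prod.mk.injEq, true_and] at h
  obtain ⟨h1, h2, h3, h4, h5, h6, h7⟩ := h
  have h1 := Fin.val_injective h1
  have h2 := finsetCode_injective h2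
  have h3 := finsetCode_injective h3
  have h4 : l = l' := by
    funext q
    have := congrFun (List.ofFn_injective h4) q
    rw [← Finset.sort_toFinset (l q) (· ≤ ·), this, Finset.sort_toFinset]
  have h5 : v = v' := by
    funext q
    exact SimpleConstraint.code_injective (congrFun (List.ofFn_injective h5) q)
  have h6 : r = r' := by
    funext q
    exact List.ofFn_injective (congrFun (List.ofFn_injective h6) q)
  have h7 := List.map_injective_iff.2 METAEdge.code_injective h7
  subst h1 h2 h3 h4 h5 h6 h7
  rfl

/-- Two guarded METAs with the same description have the same numbers of actions, locations,
clocks and energy variables, and they are equal. -/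
theorem GuardedMETA.eq_of_code_eq {k n x m k' n' x' m' : ℕ} (A : FinMETA k n x m)
    (B : FinMETA k' n' x' m') (h : A.code = B.code) :
    k = k' ∧ n = n' ∧ x = x' ∧ m = m' ∧ HEq A B := by
  have h' := h
  simp only [GuardedMETA.code, Prod.mk.injEq] at h'
  obtain ⟨rfl, rfl, rfl, rfl, -⟩ := h'
  exact ⟨rfl, rfl, rfl, rfl, heq_of_eq (GuardedMETA.code_injective h)⟩

/-! The proof reduces the halting problem on input `0` to opacity. For a program with number `n`, an
automaton is built in which every location has the invariant "clock at most `0`", so no time elapses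
and the two energies behave as counters: non-negativity blocks decrements below zero, and guards
give zero tests. From the initial location one branch goes silently through the private location to
the final one, and always yields the observation `0`. The other branch loads `2 ^ n` into the first
energy and enters a two-counter automaton whose exit is reached exactly if the program halts, and
then only with both counters empty. Hence the private observations form a singleton, and the public
ones form the same singleton or the empty set. In this situation all three opacity notions, with or
without durations, say that the program halts (`opacityKind_rel_singleton`, `hub_opaque_iff`).

The two-counter automaton comes from a chain of simulations. Programs are treated as relations built
from basic instructions by composition and iteration; union is not needed, because a while loop is
an iteration followed by a zero test, and iterations that stop too early are blocked by that test.
Partial recursive functions are computed by such programs over registers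
(`RegComputes.of_partrec'`). Following Minsky, the registers are stored as prime exponents of a
single number, with the second counter as scratch space (`exists_simulates`,
`exists_counter_halting`). As in Kleene's theorem, the resulting rational relation is realized by a
finite automaton (`exists_counterAutomaton`). Applied to the universal function this gives one
automaton for all `n`; only the loading offset `2 ^ n` varies, so the reduction is computable. -/

open Function Relation

/-! ### Register programs as relations -/

/-- The closure of a class `B` of relations under composition and iteration. -/
inductive RationalRel {D : Type} (B : (D → D → Prop) → Prop) : (D → D → Prop) → Prop
  | base {R} : B R → RationalRel B R
  | comp {R S} : RationalRel B R → RationalRel B S → RationalRel B (Comp R S)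
  | star {R} : RationalRel B R → RationalRel B (ReflTransGen R)

/-- The instructions of a register machine: increment, decrement and zero test of a register. -/
inductive RegInstr : ((ℕ → ℕ) → (ℕ → ℕ) → Prop) → Prop
  | inc (i : ℕ) : RegInstr fun s t => t = update s i (s i + 1)
  | dec (i : ℕ) : RegInstr fun s t => s i ≠ 0 ∧ t = update s i (s i - 1)
  | isZero (i : ℕ) : RegInstr fun s t => s i = 0 ∧ t = s

/-- Some register program behaves as the relation `G` on the register contents satisfying `P`. -/
def Performs (P : (ℕ → ℕ) → Prop) (G : (ℕ → ℕ) → (ℕ → ℕ) → Prop) : Prop :=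
  ∃ R, RationalRel RegInstr R ∧ ∀ s, P s → ∀ t, R s t ↔ G s t

namespace Performs

variable {P Q : (ℕ → ℕ) → Prop} {G H : (ℕ → ℕ) → (ℕ → ℕ) → Prop}

theorem congr (h : Performs P G) (h' : ∀ s, P s → ∀ t, G s t ↔ H s t) : Performs P H := by
  obtain ⟨R, hR, hRG⟩ := h
  exact ⟨R, hR, fun s hs t => (hRG s hs t).trans (h' s hs t)⟩

theorem mono (h : Performs P G) (h' : ∀ s, Q s → P s) : Performs Q G := by
  obtain ⟨R, hR, hRG⟩ := h
  exact ⟨R, hR, fun s hs t => hRG s (h' s hs) t⟩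

theorem instr (h : RegInstr G) : Performs P G :=
  ⟨G, .base h, fun _ _ _ => Iff.rfl⟩

theorem comp (hG : Performs P G) (hH : Performs Q H) (h : ∀ s, P s → ∀ t, G s t → Q t) :
    Performs P (Comp G H) := by
  obtain ⟨R, hR, hRG⟩ := hG
  obtain ⟨S, hS, hSH⟩ := hH
  refine ⟨_, hR.comp hS, fun s hs t => exists_congr fun u => ?_⟩
  rw [hRG s hs]
  exact and_congr_right fun hu => hSH u (h s hs u hu) t

theorem star (hG : Performs P G) (h : ∀ s, P s → ∀ t, G s t → P t) :
    Performs P (ReflTransGen G) := by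
  obtain ⟨R, hR, hRG⟩ := hG
  refine ⟨_, hR.star, fun s hs t => ⟨fun hst => ?_, fun hst => ?_⟩⟩
  · induction hst using ReflTransGen.head_induction_on with
    | refl => exact .refl
    | head h1 _ ih =>
      have h1 := (hRG _ hs _).1 h1
      exact .head h1 (ih (h _ hs _ h1))
  · induction hst using ReflTransGen.head_induction_on with
    | refl => exact .refl
    | head h1 _ ih => exact .head ((hRG _ hs _).2 h1) (ih (h _ hs _ h1))

/-- Composition of functions. -/
theorem funComp {F F' : (ℕ → ℕ) → ℕ → ℕ} (hF : Performs P fun s t => t = F s)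
    (hF' : Performs Q fun s t => t = F' s) (h : ∀ s, P s → Q (F s)) :
    Performs P fun s t => t = F' (F s) :=
  (hF.comp hF' fun s hs t ht => ht ▸ h s hs).congr fun s _ t => by simp [Comp]

/-- A loop which decrements the register `c` until it is zero. -/
theorem loop (c : ℕ) (F : (ℕ → ℕ) → ℕ → ℕ) (hF : Performs P fun s t => s c ≠ 0 ∧ t = F s)
    (hP : ∀ s, P s → s c ≠ 0 → P (F s)) (hc : ∀ s, P s → s c ≠ 0 → F s c = s c - 1) :
    Performs P fun s t => t = F^[s c] s := by
  refine ((hF.star fun s hs t ht => ?_).comp (instr (P := fun _ => True) (.isZero c))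
    fun _ _ _ _ => trivial).congr fun s hs t => ?_
  · rw [ht.2]; exact hP s hs ht.1
  -- The iteration may stop after any round, but the zero test only accepts a stop when `c` is
  -- empty, which fixes the number of rounds as `s c`.
  constructor
  · rintro ⟨u, hu, huc, rfl⟩
    induction hu using ReflTransGen.head_induction_on with
    | refl => simp [huc]
    | head h1 _ ih =>
      obtain ⟨h0, rfl⟩ := h1
      rw [ih (hP _ hs h0), hc _ hs h0, ← iterate_succ_apply]
      congr 2; omega
  · rintro rfl
    refine ⟨F^[s c] s, ?_⟩
    generalize hn : s c = n
    induction n generalizing s with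
    | zero => exact ⟨.refl, hn, rfl⟩
    | succ n ih =>
      have h0 : s c ≠ 0 := by omega
      obtain ⟨h1, h2⟩ := ih (F s) (hP s hs h0) (by rw [hc s hs h0]; omega)
      exact ⟨.head ⟨h0, rfl⟩ h1, h2⟩

theorem setZero (c : ℕ) : Performs P fun s t => t = update s c 0 := by
  refine ((loop (P := fun _ => True) c (fun s => update s c (s c - 1)) (instr (.dec c))
    (fun _ _ _ => trivial) (fun s _ _ => by simp)).congr fun s _ t => ?_).mono fun _ _ => trivial
  have (n : ℕ) : (fun s : ℕ → ℕ => update s c (s c - 1))^[n] s = update s c (s c - n) := by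
    induction n with
    | zero => simp
    | succ n ih => rw [iterate_succ_apply', ih]; simp [Nat.sub_sub]
  simp [this]

theorem inc (c : ℕ) : Performs P fun s t => t = update s c (s c + 1) := instr (.inc c)

/-- Empty register `a`, adding its contents to registers `b` and `c`. -/
theorem addTo₂ {a b c : ℕ} (hab : a ≠ b) (hac : a ≠ c) (hbc : b ≠ c) :
    Performs P fun s t => t = update (update (update s b (s b + s a)) c (s c + s a)) a 0 := by
  refine ((loop (P := fun _ => True) a
    (fun s => update (update (update s a (s a - 1)) b (s b + 1)) c (s c + 1)) ?_
    (fun _ _ _ => trivial) (fun s _ _ => by simp [hab, hac])).congr fun s _ t => ?_).mono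
    fun _ _ => trivial
  · refine ((instr (P := fun _ => True) (.dec a)).comp ((inc (P := fun _ => True) b).funComp
      (inc (P := fun _ => True) c) fun _ _ => trivial) fun _ _ _ _ => trivial).congr
      fun s _ t => ?_
    simp [Comp, hab.symm, hac.symm, hbc.symm]
  · have (n : ℕ) : (fun s : ℕ → ℕ =>
        update (update (update s a (s a - 1)) b (s b + 1)) c (s c + 1))^[n] s
        = update (update (update s b (s b + n)) c (s c + n)) a (s a - n) := by
      induction n with
      | zero => simp
      | succ n ih =>
        rw [iterate_succ_apply', ih]
        funext j
        grind [update_apply]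
    simp [this]

/-- Empty register `a`, adding its contents to register `b`. -/
theorem addTo {a b : ℕ} (hab : a ≠ b) :
    Performs P fun s t => t = update (update s b (s b + s a)) a 0 := by
  refine ((loop (P := fun _ => True) a
    (fun s => update (update s a (s a - 1)) b (s b + 1)) ?_
    (fun _ _ _ => trivial) (fun s _ _ => by simp [hab])).congr fun s _ t => ?_).mono
    fun _ _ => trivial
  · refine ((instr (P := fun _ => True) (.dec a)).comp (inc (P := fun _ => True) b)
      fun _ _ _ _ => trivial).congr fun s _ t => ?_
    simp [Comp, hab.symm]
  · have (n : ℕ) : (fun s : ℕ → ℕ =>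
        update (update s a (s a - 1)) b (s b + 1))^[n] s
        = update (update s b (s b + n)) a (s a - n) := by
      induction n with
      | zero => simp
      | succ n ih =>
        rw [iterate_succ_apply', ih]
        funext j
        grind [update_apply]
    simp [this]

/-- Copy register `a` to register `b`, using the empty register `c` for intermediate results. -/
theorem copy {a b c : ℕ} (hac : a ≠ c) (hbc : b ≠ c) :
    Performs (fun s => s c = 0) fun s t => t = update s b (s a) := by
  by_cases hab : a = b
  · subst hab
    -- A program that changes nothing is needed; the zero test on the empty register `c` is one.
    refine (((instr (P := fun s => s c = 0) (.isZero c)))).congr fun s hs t => ?_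
    simp only [hs, true_and, update_eq_self]
  · refine (((setZero (P := fun s => s c = 0) b).funComp
      (addTo₂ (P := fun _ => True) hab hac hbc) fun _ _ => trivial).funComp
      (addTo (P := fun _ => True) hac.symm) fun _ _ => trivial).congr fun s hs t => ?_
    refine Eq.congr_right ?_
    funext j
    grind [update_apply]

/-- Empty the registers `m, …, m + n - 1`. -/
theorem clear (m n : ℕ) :
    Performs P fun s t => t = fun j => if m ≤ j ∧ j < m + n then 0 else s j := by
  refine Performs.mono (P := fun _ => True) ?_ fun _ _ => trivial
  induction n with
  | zero =>
    -- Incrementing and then decrementing `m` is a program that changes nothing and needs no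
    -- precondition.
    refine ((inc m).comp (instr (P := fun s => s m ≠ 0) (.dec m)) ?_).congr fun s _ t => ?_
    · rintro s _ t rfl
      simp
    · have : (fun j => if m ≤ j ∧ j < m + 0 then 0 else s j) = s := by
        funext j; simp
      rw [this]
      simp [Comp]
  | succ n ih =>
    refine (ih.funComp (setZero (P := fun _ => True) (m + n)) fun _ _ => trivial).congr
      fun s _ t => Eq.congr_right ?_
    funext j
    grind [update_apply]

end Performs

/-! ### Register programs compute all partial recursive functions -/

/-- All registers from `m` on are empty. -/
def CleanFrom (m : ℕ) (s : ℕ → ℕ) : Prop := ∀ i, m ≤ i → s i = 0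

/-- The partial function `f` is computed by register programs, for every choice of input registers
`a i` and of an output register `b`, using the registers from `m` on for intermediate results. -/
def RegComputes {n : ℕ} (f : List.Vector ℕ n →. ℕ) : Prop :=
  ∀ (a : Fin n → ℕ) (b m : ℕ), (∀ i, a i < m) → b < m →
    Performs (CleanFrom m) fun s t =>
      ∃ y ∈ f (List.Vector.ofFn fun i => s (a i)), t = update s b y

theorem regComputes_total {n : ℕ} {f : List.Vector ℕ n → ℕ} :
    RegComputes (f : List.Vector ℕ n →. ℕ) ↔
    ∀ (a : Fin n → ℕ) (b m : ℕ), (∀ i, a i < m) → b < m →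
      Performs (CleanFrom m) fun s t =>
        t = update s b (f (List.Vector.ofFn fun i => s (a i))) := by
  simp [RegComputes]

theorem mem_mOfFn {n : ℕ} {g : Fin n → Part ℕ} {v : List.Vector ℕ n} :
    v ∈ List.Vector.mOfFn g ↔ ∀ i, v.get i ∈ g i := by
  induction n with
  | zero => simp [List.Vector.mOfFn, eq_iff_true_of_subsingleton]
  | succ n ih =>
    simp only [List.Vector.mOfFn, Part.bind_eq_bind, Part.mem_bind_iff, ih, Part.pure_eq_some,
      Part.mem_some_iff, Fin.forall_fin_succ]
    constructor
    · rintro ⟨x, hx, w, hw, rfl⟩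
      exact ⟨by simpa using hx, by simpa using hw⟩
    · rintro ⟨h0, h1⟩
      exact ⟨_, h0, v.tail, fun i => by rw [List.Vector.get_tail_succ]; exact h1 i,
        by rw [List.Vector.get_zero]; simp⟩

namespace RegComputes

theorem zero : RegComputes (n := 0) (fun _ => 0 : List.Vector ℕ 0 → ℕ) :=
  regComputes_total.2 fun _ b _ _ _ => Performs.setZero b

theorem get {n : ℕ} (i : Fin n) : RegComputes (n := n) (fun v => v.get i : List.Vector ℕ n → ℕ) := by
  refine regComputes_total.2 fun a b m ha hb => ?_
  simp only [List.Vector.get_ofFn]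
  exact (Performs.copy (ha i).ne hb.ne).mono fun s hs => hs m le_rfl

theorem succ : RegComputes (n := 1) (fun v => v.head.succ : List.Vector ℕ 1 → ℕ) := by
  refine regComputes_total.2 fun a b m ha hb => ?_
  refine (((Performs.copy (ha 0).ne hb.ne).funComp (Performs.inc (P := fun _ => True) b)
    fun _ _ => trivial).mono fun s hs => hs m le_rfl).congr fun s _ t => ?_
  simp [← List.Vector.get_zero]

/-- Compute `k` of the functions `g`, storing the results in the registers from `m` on. -/
theorem gather {n l : ℕ} {g : Fin n → List.Vector ℕ l →. ℕ} (hg : ∀ i, RegComputes (g i))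
    {a : Fin l → ℕ} {m : ℕ} (ha : ∀ i, a i < m) (k : ℕ) (hk : k ≤ n) :
    Performs (CleanFrom m) fun s t => ∃ y : ℕ → ℕ,
      (∀ i : Fin n, i < k → y i ∈ g i (List.Vector.ofFn fun i => s (a i))) ∧
      t = fun j => if m ≤ j ∧ j < m + k then y (j - m) else s j := by
  induction k with
  | zero =>
    refine (Performs.clear m 0).congr fun s _ t => ?_
    have (j : ℕ) : ¬ (m ≤ j ∧ j < m) := by omega
    simp [this]
  | succ k ih =>
    -- The new result goes to register `m + k`, and scratch space starts at `m + n`, above all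
    -- result registers, so earlier results survive.
    refine ((ih (by omega)).comp (hg ⟨k, hk⟩ a (m + k) (m + n) (fun i => (ha i).trans_le (by omega))
      (by omega)) ?_).congr fun s hs t => ?_
    · rintro s hs _ ⟨y, -, rfl⟩ j hj
      have h1 : ¬ (m ≤ j ∧ j < m + k) := by omega
      simpa [h1] using hs j (by omega)
    have key (y : ℕ → ℕ) : (fun i => (fun j => if m ≤ j ∧ j < m + k then y (j - m) else s j) (a i))
        = fun i => s (a i) := by
      funext i
      have := ha i
      dsimp only
      rw [if_neg (by omega)]
    constructor
    · rintro ⟨_, ⟨y, hy, rfl⟩, z, hz, rfl⟩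
      rw [key] at hz
      refine ⟨update y k z, fun i hi => ?_, ?_⟩
      · by_cases h : i.val = k
        · have : i = ⟨k, hk⟩ := Fin.ext h
          subst this
          simpa using hz
        · rw [update_of_ne h]
          exact hy i (by omega)
      · funext j
        by_cases h : j = m + k
        · subst h; simp
        · have : j - m = k → ¬ m ≤ j := by omega
          grind [update_apply]
    · rintro ⟨y, hy, rfl⟩
      refine ⟨_, ⟨y, fun i hi => hy i (by omega), rfl⟩, y k, ?_, ?_⟩
      · rw [key]
        exact hy ⟨k, hk⟩ (by simp)
      · funext j
        by_cases h : j = m + k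
        · subst h; simp
        · grind [update_apply]

/-- The inner results are gathered in the registers `m, …, m + n - 1`, from which `f` reads its
arguments. Clearing them afterwards restores the empty scratch space that `RegComputes` demands. -/
theorem comp {l n : ℕ} {f : List.Vector ℕ n →. ℕ} {g : Fin n → List.Vector ℕ l →. ℕ}
    (hf : RegComputes f) (hg : ∀ i, RegComputes (g i)) :
    RegComputes fun v => (List.Vector.mOfFn fun i => g i v) >>= f := by
  intro a b m ha hb
  refine (((gather hg ha n le_rfl).comp (hf (fun i => m + i) b (m + n) (fun i => by omega)
    (by omega)) ?_).comp (Performs.clear (P := fun _ => True) m n) fun _ _ _ _ => trivial).congr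
    fun s hs t => ?_
  · rintro s hs _ ⟨y, -, rfl⟩ j hj
    have h1 : ¬ (m ≤ j ∧ j < m + n) := by omega
    simpa [h1] using hs j (by omega)
  have hclear (y : ℕ → ℕ) (z : ℕ) : (fun j => if m ≤ j ∧ j < m + n then 0 else
      update (fun j => if m ≤ j ∧ j < m + n then y (j - m) else s j) b z j) = update s b z := by
    funext j
    have := hs j
    grind [update_apply]
  have hmem (v : List.Vector ℕ l) (z : ℕ) : z ∈ ((List.Vector.mOfFn fun i => g i v) >>= f) ↔
      ∃ w : List.Vector ℕ n, (∀ i, w.get i ∈ g i v) ∧ z ∈ f w := by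
    simp only [← mem_mOfFn (g := fun i => g i v)]
    exact Part.mem_bind_iff
  constructor
  · rintro ⟨_, ⟨_, ⟨y, hy, rfl⟩, z, hz, rfl⟩, rfl⟩
    refine ⟨z, (hmem _ z).2 ⟨List.Vector.ofFn fun i : Fin n => y i, fun i => ?_, ?_⟩, hclear y z⟩
    · rw [List.Vector.get_ofFn]
      exact hy i i.2
    · simpa using hz
  · rintro ⟨z, hz, rfl⟩
    obtain ⟨v, hv, hz⟩ := (hmem _ z).1 hz
    refine ⟨_, ⟨_, ⟨fun i => if h : i < n then v.get ⟨i, h⟩ else 0, fun i _ => ?_, rfl⟩, z, ?_, rfl⟩,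
      (hclear (fun i => if h : i < n then v.get ⟨i, h⟩ else 0) z).symm⟩
    · simpa using hv i
    · simpa using hz

theorem comp_total {l n : ℕ} {f : List.Vector ℕ n → ℕ} {g : Fin n → List.Vector ℕ l → ℕ}
    (hf : RegComputes (f : List.Vector ℕ n →. ℕ))
    (hg : ∀ i, RegComputes (g i : List.Vector ℕ l →. ℕ)) :
    RegComputes (n := l) (fun v => f (List.Vector.ofFn fun i => g i v) : List.Vector ℕ l → ℕ) := by
  have h := hf.comp hg
  have heq : (fun v => (List.Vector.mOfFn fun i => (g i : List.Vector ℕ l →. ℕ) v) >>=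
      (f : List.Vector ℕ n →. ℕ)) =
      ((fun v => f (List.Vector.ofFn fun i => g i v) : List.Vector ℕ l → ℕ) :
        List.Vector ℕ l →. ℕ) :=
    funext fun v => (congrArg (Part.bind · (f : List.Vector ℕ n →. ℕ))
      (Vector.mOfFn_part_some fun i => g i v)).trans (Part.bind_some _ _)
  exact heq ▸ h

theorem ofFn_succ {n : ℕ} (f : Fin (n + 1) → ℕ) :
    List.Vector.ofFn f = f 0 ::ᵥ List.Vector.ofFn fun i => f i.succ := rfl

/-- Register `m` counts the completed rounds, `m + 1` accumulates the recursive value, and `m + 2`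
holds the rounds still to do. The last is a copy of the recursion argument, since inputs must be
preserved. -/
theorem prec {n : ℕ} {f : List.Vector ℕ n → ℕ} {g : List.Vector ℕ (n + 2) → ℕ}
    (hf : RegComputes (f : List.Vector ℕ n →. ℕ))
    (hg : RegComputes (g : List.Vector ℕ (n + 2) →. ℕ)) :
    RegComputes (n := n + 1) (fun v => v.head.rec (f v.tail) fun y IH => g (y ::ᵥ IH ::ᵥ v.tail) :
      List.Vector ℕ (n + 1) → ℕ) := by
  refine regComputes_total.2 fun a b m ha hb => ?_
  rw [regComputes_total] at hf hg
  have ha' (i : Fin n) : a i.succ < m := ha i.succ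
  have h0 := ha 0
  let args : Fin (n + 2) → ℕ := Fin.cons m (Fin.cons (m + 1) fun i => a i.succ)
  let body : (ℕ → ℕ) → ℕ → ℕ := fun s =>
    update (update (update s (m + 2) (s (m + 2) - 1)) (m + 1)
      (g (s m ::ᵥ s (m + 1) ::ᵥ List.Vector.ofFn fun i => s (a i.succ)))) m (s m + 1)
  have hbody : Performs (CleanFrom (m + 3)) fun s t => s (m + 2) ≠ 0 ∧ t = body s := by
    -- Here `g` overwrites one of its own inputs, the accumulator `m + 1`; `RegComputes` allows the
    -- output register to be among the inputs.
    refine ((Performs.instr (.dec (m + 2))).comp ((hg args (m + 1) (m + 3) ?_ (by omega)).funComp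
      (Performs.inc (P := fun _ => True) m) fun _ _ => trivial) ?_).congr fun s hs t => ?_
    · refine Fin.cases (by simp [args]) (Fin.cases (by simp [args]) fun i => ?_)
      simp only [args, Fin.cons_succ]
      exact (ha' i).trans_le (by omega)
    · rintro s hs t ⟨-, rfl⟩ j hj
      rw [update_of_ne (by omega)]
      exact hs j hj
    · have (i : Fin n) : a i.succ ≠ m + 2 := by have := ha' i; omega
      simp [Comp, args, body, ofFn_succ, this]
  have hclean (s : ℕ → ℕ) (hs : CleanFrom (m + 3) s) : CleanFrom (m + 3) (body s) := by
    intro j hj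
    simp only [body]
    rw [update_of_ne (by omega), update_of_ne (by omega), update_of_ne (by omega)]
    exact hs j hj
  have hloop := Performs.loop (m + 2) body hbody (fun s hs _ => hclean s hs)
    (fun s _ _ => by simp [body])
  have hclean' (k : ℕ) (s : ℕ → ℕ) (hs : CleanFrom (m + 3) s) :
      CleanFrom (m + 3) (body^[k] s) := by
    induction k generalizing s with
    | zero => exact hs
    | succ k ih => exact ih _ (hclean s hs)
  have hupd (s : ℕ → ℕ) (i z : ℕ) (hi : i < m + 3) (hs : CleanFrom (m + 3) s) :
      CleanFrom (m + 3) (update s i z) := by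
    intro j hj
    rw [update_of_ne (by omega)]
    exact hs j hj
  refine (((((hf (fun i => a i.succ) (m + 1) (m + 3) (fun i => (ha' i).trans_le (by omega))
    (by omega)).funComp (Performs.copy (a := a 0) (b := m + 2) (c := m + 3) (by omega) (by omega))
    ?_).funComp hloop ?_).funComp
    (Performs.copy (a := m + 1) (b := b) (c := m + 3) (by omega) (by omega)) ?_).funComp
    (Performs.clear (P := fun _ => True) m 3) fun _ _ => trivial).mono
    (fun s hs j hj => hs j (by omega)) |>.congr fun s hs t => Eq.congr_right ?_
  · exact fun s hs => hupd _ _ _ (by omega) hs _ le_rfl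
  · exact fun s hs => hupd _ _ _ (by omega) (hupd _ _ _ (by omega) hs)
  · exact fun s hs => hclean' _ _ (hupd _ _ _ (by omega) (hupd _ _ _ (by omega) hs)) _ le_rfl
  · set v := List.Vector.ofFn fun i => s (a i.succ) with hv
    let rc : ℕ → ℕ := fun k => k.rec (f v) fun y IH => g (y ::ᵥ IH ::ᵥ v)
    have hrc0 : rc 0 = f v := rfl
    have hrcs (k : ℕ) : rc (k + 1) = g (k ::ᵥ rc k ::ᵥ v) := rfl
    have hgoal : (s (a 0)).rec (f v) (fun y IH => g (y ::ᵥ IH ::ᵥ v)) = rc (s (a 0)) := rfl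
    have happ (s : ℕ → ℕ) : body s = update (update (update s (m + 2) (s (m + 2) - 1)) (m + 1)
      (g (s m ::ᵥ s (m + 1) ::ᵥ List.Vector.ofFn fun i => s (a i.succ)))) m (s m + 1) := rfl
    have hsm : s m = 0 := hs m le_rfl
    have hsm1 : s (m + 1) = 0 := hs _ (by omega)
    have hsm2 : s (m + 2) = 0 := hs _ (by omega)
    clear_value rc body args
    clear hclean hclean' hloop hbody hs hf hg
    -- The loop invariant. Truncated subtraction makes it valid for every `k`.
    have hrc (k : ℕ) : body^[k] (update (update s (m + 1) (f v)) (m + 2) (s (a 0)))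
        = update (update (update s (m + 2) (s (a 0) - k)) (m + 1) (rc k)) m k := by
      induction k with
      | zero =>
        rw [iterate_zero, id]
        clear happ hrcs hv
        funext j
        grind [update_apply]
      | succ k ih =>
        have h1 (i : Fin n) : a i.succ ≠ m := (ha' i).ne
        have h2 (i : Fin n) : a i.succ ≠ m + 1 := by have := ha' i; omega
        have h3 (i : Fin n) : a i.succ ≠ m + 2 := by have := ha' i; omega
        rw [iterate_succ_apply', ih]
        rw [happ]
        have h4 : (List.Vector.ofFn fun i : Fin n => update (update (update s (m + 2)
            (s (a 0) - k)) (m + 1) (rc k)) m k (a i.succ)) = v := by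
          simp [h1, h2, h3, hv]
        rw [h4, update_self, update_of_ne (a := m + 1) (by omega), update_self, ← hrcs]
        clear happ h4 hv hrcs ih
        funext j
        grind [update_apply]
    have h6 : update (update s (m + 1) (f v)) (m + 2)
        (update s (m + 1) (f v) (a 0)) = update (update s (m + 1) (f v)) (m + 2) (s (a 0)) := by
      rw [update_of_ne (a := a 0) (by omega)]
    rw [h6, update_self, hrc, ofFn_succ, List.Vector.head_cons, List.Vector.tail_cons, ← hv, hgoal]
    clear happ hv hrcs hrc h6 hgoal
    funext j
    grind [update_apply]

/-- Register `m` holds the candidate and `m + 1` the value of `f` there. The number of rounds is not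
known beforehand, so the search is a bare iteration closed by a zero test; it has no accepted end if
`f` has no zero, as unbounded search requires. -/
theorem rfind {n : ℕ} {f : List.Vector ℕ (n + 1) → ℕ}
    (hf : RegComputes (f : List.Vector ℕ (n + 1) →. ℕ)) :
    RegComputes fun v => Nat.rfind fun k => Part.some (f (k ::ᵥ v) = 0) := by
  intro a b m ha hb
  rw [regComputes_total] at hf
  let args : Fin (n + 1) → ℕ := Fin.cons m a
  have hf' := hf args (m + 1) (m + 2) (Fin.cases (by simp [args]) fun i => by
    simp only [args, Fin.cons_succ]
    exact (ha i).trans_le (by omega)) (by omega)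
  let next : (ℕ → ℕ) → ℕ → ℕ := fun s => update (update s m (s m + 1)) (m + 1)
    (f ((s m + 1) ::ᵥ List.Vector.ofFn fun i => s (a i)))
  have hne (i : Fin n) : a i ≠ m := (ha i).ne
  have hne' (i : Fin n) : a i ≠ m + 1 := by have := ha i; omega
  have hupd (s : ℕ → ℕ) (i z : ℕ) (hi : i < m + 2) (hs : CleanFrom (m + 2) s) :
      CleanFrom (m + 2) (update s i z) := by
    intro j hj
    rw [update_of_ne (by omega)]
    exact hs j hj
  have hbody : Performs (CleanFrom (m + 2)) fun s t => s (m + 1) ≠ 0 ∧ t = next s := by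
    -- The decrement only tests that `m + 1` is non-zero; the next value of `f` overwrites its
    -- result.
    refine ((Performs.instr (.dec (m + 1))).comp ((Performs.inc (P := CleanFrom (m + 2)) m).funComp
      hf' fun s hs => hupd _ _ _ (by omega) hs) ?_).congr fun s hs t => ?_
    · rintro s hs t ⟨-, rfl⟩
      exact hupd _ _ _ (by omega) hs
    · have (z : ℕ) : update (update (update s (m + 1) (s (m + 1) - 1)) m (s m + 1)) (m + 1) z =
          update (update s m (s m + 1)) (m + 1) z := by
        funext j
        grind [update_apply]
      simp [Comp, args, next, ofFn_succ, hne, hne', this]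
  have hloop := hbody.star (fun s hs t ht => by
    rw [ht.2]
    exact hupd _ _ _ (by omega) (hupd _ _ _ (by omega) hs))
  have hreach (s : ℕ → ℕ) (hs : CleanFrom (m + 2) s) (t : ℕ → ℕ)
      (hst : ReflTransGen (fun s t => s (m + 1) ≠ 0 ∧ t = next s) s t) : CleanFrom (m + 2) t := by
    induction hst with
    | refl => exact hs
    | tail _ h ih =>
      rw [h.2]
      exact hupd _ _ _ (by omega) (hupd _ _ _ (by omega) ih)
  -- After the zero test `m + 1` is already empty, so emptying `m` is enough to restore the scratch
  -- registers.
  have hcopy := (Performs.copy (a := m) (b := b) (c := m + 2) (by omega) (by omega)).funComp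
    (Performs.setZero (P := fun _ => True) m) fun _ _ => trivial
  refine ((((hf'.comp hloop ?_).comp (Performs.instr (P := CleanFrom (m + 2)) (.isZero (m + 1)))
    ?_).comp hcopy ?_).mono fun s hs j hj => hs j (by omega)).congr fun s hs t => ?_
  · rintro s hs _ rfl
    exact hupd _ _ _ (by omega) hs
  · rintro s hs t ⟨_, rfl, h⟩
    exact hreach _ (hupd _ _ _ (by omega) hs) _ h
  · rintro s hs _ ⟨t, ⟨_, rfl, h⟩, -, rfl⟩
    exact hreach _ (hupd _ _ _ (by omega) hs) _ h _ le_rfl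
  set v := List.Vector.ofFn fun i => s (a i) with hv
  let st : ℕ → ℕ → ℕ := fun k => update (update s m k) (m + 1) (f (k ::ᵥ v))
  have hsm : s m = 0 := hs m le_rfl
  have hst0 : update s (m + 1) (f (List.Vector.ofFn fun i => s (args i))) = st 0 := by
    funext j
    have : (List.Vector.ofFn fun i => s (args i)) = 0 ::ᵥ v := by
      simp [ofFn_succ, args, hsm, hv]
    rw [this]
    grind [update_apply]
  have hnext (k : ℕ) : next (st k) = st (k + 1) := by
    have h1 : (List.Vector.ofFn fun i => st k (a i)) = v := by
      simp [st, hne, hne', hv]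
    have h2 : st k m = k := by simp [st]
    simp only [next, h1, h2]
    funext j
    grind [update_apply]
  have hstc (k : ℕ) : st k (m + 1) = f (k ::ᵥ v) := by simp [st]
  -- The search gets past a candidate only if `f` is non-zero there, so stopping at a zero means
  -- stopping at the least one.
  have hstar (u : ℕ → ℕ) : ReflTransGen (fun s t => s (m + 1) ≠ 0 ∧ t = next s) (st 0) u ↔
      ∃ k, (∀ i < k, f (i ::ᵥ v) ≠ 0) ∧ u = st k := by
    constructor
    · intro h
      induction h with
      | refl => exact ⟨0, by simp, rfl⟩
      | tail _ h ih =>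
        obtain ⟨k, hk, rfl⟩ := ih
        obtain ⟨h1, rfl⟩ := h
        rw [hstc] at h1
        refine ⟨k + 1, fun i hi => ?_, hnext k⟩
        rcases Nat.lt_succ_iff_lt_or_eq.1 hi with hi | rfl
        · exact hk i hi
        · exact h1
    · rintro ⟨k, hk, rfl⟩
      induction k with
      | zero => exact .refl
      | succ k ih =>
        exact (ih fun i hi => hk i (by omega)).tail
          ⟨by rw [hstc]; exact hk k (by omega), (hnext k).symm⟩
  have hend (k : ℕ) (hk : f (k ::ᵥ v) = 0) :
      update (update (st k) b (st k m)) m 0 = update s b k := by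
    funext j
    have := hs (m + 1) (by omega)
    grind [update_apply]
  have hmem (k : ℕ) : k ∈ (Nat.rfind fun k => Part.some (f (k ::ᵥ v) = 0)) ↔
      f (k ::ᵥ v) = 0 ∧ ∀ i < k, f (i ::ᵥ v) ≠ 0 := Nat.mem_rfind.trans (by simp)
  constructor
  · rintro ⟨_, ⟨u, ⟨_, rfl, hu⟩, hu0, rfl⟩, rfl⟩
    rw [hst0, hstar] at hu
    obtain ⟨k, hk, rfl⟩ := hu
    rw [hstc] at hu0
    exact ⟨k, (hmem k).2 ⟨hu0, hk⟩, hend k hu0⟩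
  · rintro ⟨k, hk, rfl⟩
    obtain ⟨hk0, hk⟩ := (hmem k).1 hk
    refine ⟨_, ⟨_, ⟨_, rfl, ?_⟩, ?_, rfl⟩, (hend k hk0).symm⟩
    · rw [hst0, hstar]
      exact ⟨k, hk, rfl⟩
    · rw [hstc, hk0]

theorem of_primrec' {n : ℕ} {f : List.Vector ℕ n → ℕ} (hf : Nat.Primrec' f) :
    RegComputes (f : List.Vector ℕ n →. ℕ) := by
  induction hf with
  | zero => exact zero
  | succ => exact succ
  | get i => exact get i
  | comp g _ _ hf hg => exact hf.comp_total hg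
  | prec _ _ hf hg => exact hf.prec hg

theorem of_partrec' {n : ℕ} {f : List.Vector ℕ n →. ℕ} (hf : Nat.Partrec' f) :
    RegComputes f := by
  induction hf with
  | prim hf => exact of_primrec' hf
  | comp g _ _ hf hg => exact hf.comp hg
  | rfind _ hf => exact hf.rfind

end RegComputes

/-! ### Arithmetic on two counters -/

/-- The effect of an edge with guard `g` and offsets `u` on two counters. -/
def counterRel (g : SimpleConstraint (Fin 1) (Fin 2)) (u : Fin 2 → ℤ) (d e : Fin 2 → ℕ) : Prop :=
  g.Sat (fun _ => 0) (fun i => (d i : ℝ)) ∧ ∀ i, (e i : ℤ) = d i + u i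

/-- The instructions of a two-counter machine. -/
inductive CounterInstr : ((Fin 2 → ℕ) → (Fin 2 → ℕ) → Prop) → Prop
  | mk (g : SimpleConstraint (Fin 1) (Fin 2)) (u : Fin 2 → ℤ) : CounterInstr (counterRel g u)

abbrev CounterRational := RationalRel CounterInstr

theorem counterRel_add {d e : Fin 2 → ℕ} {a b : ℤ} :
    counterRel [] ![a, b] d e ↔ (e 0 : ℤ) = d 0 + a ∧ (e 1 : ℤ) = d 1 + b := by
  simp [counterRel, SimpleConstraint.Sat, Fin.forall_fin_two]

theorem counterRel_le {d e : Fin 2 → ℕ} {i : Fin 2} {c : ℕ} :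
    counterRel [⟨.inr i, .le, c⟩] 0 d e ↔ d i ≤ c ∧ e = d := by
  simp [counterRel, SimpleConstraint.Sat, Cmp.Holds, funext_iff]

theorem counterRel_interval {d e : Fin 2 → ℕ} {i : Fin 2} {b c : ℕ} :
    counterRel [⟨.inr i, .ge, b⟩, ⟨.inr i, .le, c⟩] 0 d e ↔ (b ≤ d i ∧ d i ≤ c) ∧ e = d := by
  simp [counterRel, SimpleConstraint.Sat, Cmp.Holds, funext_iff]

theorem eq_vec_iff {d : Fin 2 → ℕ} {x y : ℕ} : d = ![x, y] ↔ d 0 = x ∧ d 1 = y := by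
  simp [funext_iff, Fin.forall_fin_two]

/-- The loop which takes `a` from the first counter and adds `b` to the second one. -/
theorem star_move {a b x y : ℕ} {e : Fin 2 → ℕ} :
    ReflTransGen (counterRel [] ![-(a : ℤ), b]) ![x, y] e ↔
      ∃ k, k * a ≤ x ∧ e = ![x - k * a, y + k * b] := by
  constructor
  · intro h
    induction h with
    | refl => exact ⟨0, by simp, by simp⟩
    | tail _ h ih =>
      obtain ⟨k, hk, rfl⟩ := ih
      rw [counterRel_add] at h
      simp only [Matrix.cons_val_zero, Matrix.cons_val_one] at h
      have h1 : (k + 1) * a = k * a + a := by ring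
      have h2 : (k + 1) * b = k * b + b := by ring
      refine ⟨k + 1, by omega, eq_vec_iff.2 ⟨by omega, by omega⟩⟩
  · rintro ⟨k, hk, rfl⟩
    induction k with
    | zero => simp [ReflTransGen.refl]
    | succ k ih =>
      have h1 : (k + 1) * a = k * a + a := by ring
      have h2 : (k + 1) * b = k * b + b := by ring
      refine (ih (by omega)).tail (counterRel_add.2 ?_)
      simp only [Matrix.cons_val_zero, Matrix.cons_val_one]
      omega

/-- The loop which moves units from the second counter to the first one. -/
theorem star_back {x y : ℕ} {e : Fin 2 → ℕ} :
    ReflTransGen (counterRel [] ![1, -1]) ![x, y] e ↔ ∃ k ≤ y, e = ![x + k, y - k] := by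
  constructor
  · intro h
    induction h with
    | refl => exact ⟨0, by simp, by simp⟩
    | tail _ h ih =>
      obtain ⟨k, hk, rfl⟩ := ih
      rw [counterRel_add] at h
      simp only [Matrix.cons_val_zero, Matrix.cons_val_one] at h
      refine ⟨k + 1, by omega, eq_vec_iff.2 ⟨by omega, by omega⟩⟩
  · rintro ⟨k, hk, rfl⟩
    induction k with
    | zero => simp [ReflTransGen.refl]
    | succ k ih =>
      refine (ih (by omega)).tail (counterRel_add.2 ?_)
      simp only [Matrix.cons_val_zero, Matrix.cons_val_one]
      omega

/-- Move the contents of the second counter to the first one. -/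
theorem exists_restore : ∃ T, CounterRational T ∧ ∀ x y e, T ![x, y] e ↔ e = ![x + y, 0] := by
  refine ⟨_, (RationalRel.base (.mk [] ![1, -1])).star.comp
    (.base (.mk [⟨.inr 1, .le, (0 : ℕ)⟩] 0)), fun x y e => ?_⟩
  simp only [Comp, star_back, counterRel_le]
  constructor
  · rintro ⟨_, ⟨k, hk, rfl⟩, h, rfl⟩
    have h : y - k ≤ 0 := h
    obtain rfl : k = y := by omega
    simp
  · rintro rfl
    exact ⟨_, ⟨y, le_rfl, by simp⟩, by simp, rfl⟩

/-- Take `a` from the first counter and add `b` to the second one as often as possible, continue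
if the value left in the first counter is in an interval, and restore the first counter. -/
theorem exists_convert (a b l u : ℕ) : ∃ T, CounterRational T ∧ ∀ N e, T ![N, 0] e ↔
    ∃ k, k * a ≤ N ∧ l ≤ N - k * a ∧ N - k * a ≤ u ∧ e = ![N - k * a + k * b, 0] := by
  obtain ⟨R, hR, hRe⟩ := exists_restore
  refine ⟨_, ((RationalRel.base (.mk [] ![-(a : ℤ), b])).star.comp
    (.base (.mk [⟨.inr 0, .ge, l⟩, ⟨.inr 0, .le, u⟩] 0))).comp hR, fun N e => ?_⟩
  simp only [Comp, star_move, counterRel_interval]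
  constructor
  · rintro ⟨_, ⟨_, ⟨k, hk, rfl⟩, ⟨h1, h2⟩, rfl⟩, h⟩
    rw [hRe] at h
    simp only [Matrix.cons_val_zero] at h1 h2
    exact ⟨k, hk, h1, h2, by simpa using h⟩
  · rintro ⟨k, hk, h1, h2, rfl⟩
    exact ⟨_, ⟨_, ⟨k, hk, rfl⟩, ⟨h1, h2⟩, rfl⟩, by simp [hRe]⟩

/-- Each unit is traded for `p` units, and the interval `[0, 0]` for the remainder forces all of
them to be traded. -/
theorem exists_mul (p : ℕ) : ∃ T, CounterRational T ∧ ∀ N e, T ![N, 0] e ↔ e = ![N * p, 0] := by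
  obtain ⟨T, hT, hTe⟩ := exists_convert 1 p 0 0
  refine ⟨T, hT, fun N e => (hTe N e).trans ⟨?_, ?_⟩⟩
  · rintro ⟨k, h1, -, h2, rfl⟩
    obtain rfl : k = N := by omega
    simp
  · rintro rfl
    exact ⟨N, by simp, by simp, by simp, by simp⟩

/-- Trading `p` units for one, with remainder `0` required, succeeds only on multiples of `p`. -/
theorem exists_div {p : ℕ} (hp : 0 < p) : ∃ T, CounterRational T ∧
    ∀ N e, T ![N, 0] e ↔ p ∣ N ∧ e = ![N / p, 0] := by
  obtain ⟨T, hT, hTe⟩ := exists_convert p 1 0 0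
  refine ⟨T, hT, fun N e => (hTe N e).trans ⟨?_, ?_⟩⟩
  · rintro ⟨k, h1, -, h2, rfl⟩
    obtain rfl : N = k * p := by omega
    simp [hp]
  · rintro ⟨⟨k, rfl⟩, rfl⟩
    have : p * k - k * p = 0 := by rw [mul_comm]; simp
    exact ⟨k, by rw [mul_comm], by simp, by omega, by simp [this, hp]⟩

/-- Trading `p` units for `p` units preserves the total, while the interval `[1, p - 1]` for the
remainder tests non-divisibility. -/
theorem exists_notDvd {p : ℕ} (hp : 0 < p) : ∃ T, CounterRational T ∧
    ∀ N e, T ![N, 0] e ↔ ¬ p ∣ N ∧ e = ![N, 0] := by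
  obtain ⟨T, hT, hTe⟩ := exists_convert p p 1 (p - 1)
  refine ⟨T, hT, fun N e => (hTe N e).trans ⟨?_, ?_⟩⟩
  · rintro ⟨k, h1, h2, h3, rfl⟩
    rw [Nat.sub_add_cancel h1]
    refine ⟨fun h => ?_, rfl⟩
    have : p ∣ N - k * p := Nat.dvd_sub h (dvd_mul_left p k)
    have := Nat.le_of_dvd (by omega) this
    omega
  · rintro ⟨h, rfl⟩
    have h1 := Nat.div_add_mod' N p
    have h2 := Nat.mod_lt N hp
    have h3 : N % p ≠ 0 := fun h' => h (Nat.dvd_of_mod_eq_zero h')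
    exact ⟨N / p, by omega, by omega, by omega, by rw [Nat.sub_add_cancel (by omega)]⟩

/-! ### Registers as prime exponents -/

/-- The number `N` represents the register contents `s`: the exponents of its prime factors are
the contents of the registers. -/
def Represents (N : ℕ) (s : ℕ → ℕ) : Prop :=
  N ≠ 0 ∧ ∀ i, N.factorization (Nat.nth Nat.Prime i) = s i

theorem factorization_nth_prime (i j : ℕ) :
    (Nat.nth Nat.Prime i).factorization (Nat.nth Nat.Prime j) = if j = i then 1 else 0 := by
  rw [(Nat.prime_nth_prime i).factorization, Finsupp.single_apply]
  have := (Nat.nth_injective Nat.infinite_setOfPred_prime).eq_iff (a := i) (b := j)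
  simp only [this, eq_comm]

theorem Represents.dvd_iff {N : ℕ} {s : ℕ → ℕ} (h : Represents N s) (i : ℕ) :
    Nat.nth Nat.Prime i ∣ N ↔ s i ≠ 0 := by
  rw [← h.2 i, (Nat.prime_nth_prime i).dvd_iff_one_le_factorization h.1]
  omega

theorem Represents.mul {N : ℕ} {s : ℕ → ℕ} (h : Represents N s) (i : ℕ) :
    Represents (N * Nat.nth Nat.Prime i) (update s i (s i + 1)) := by
  have hp := (Nat.prime_nth_prime i).ne_zero
  refine ⟨mul_ne_zero h.1 hp, fun j => ?_⟩
  rw [Nat.factorization_mul h.1 hp, Finsupp.add_apply, h.2, factorization_nth_prime, update_apply]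
  split_ifs with hj <;> simp [hj]

theorem Represents.div {N : ℕ} {s : ℕ → ℕ} (h : Represents N s) {i : ℕ} (hi : s i ≠ 0) :
    Represents (N / Nat.nth Nat.Prime i) (update s i (s i - 1)) := by
  have hd := (h.dvd_iff i).2 hi
  refine ⟨(Nat.div_pos (Nat.le_of_dvd (Nat.pos_of_ne_zero h.1) hd)
    (Nat.prime_nth_prime i).pos).ne', fun j => ?_⟩
  rw [Nat.factorization_div hd, Finsupp.tsub_apply, h.2, factorization_nth_prime, update_apply]
  split_ifs with hj <;> simp [hj]

/-- The two-counter relation `T` simulates the relation `R` on register contents. -/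
def Simulates (T : (Fin 2 → ℕ) → (Fin 2 → ℕ) → Prop) (R : (ℕ → ℕ) → (ℕ → ℕ) → Prop) : Prop :=
  ∀ N s, Represents N s →
    (∀ e, T ![N, 0] e → ∃ M t, R s t ∧ Represents M t ∧ e = ![M, 0]) ∧
    (∀ t, R s t → ∃ M, Represents M t ∧ T ![N, 0] ![M, 0])

/-- Increment, decrement and zero test of register `i` become multiplication by the corresponding
prime, exact division by it, and the test that it does not divide. -/
theorem exists_simulates_instr {R : (ℕ → ℕ) → (ℕ → ℕ) → Prop} (hR : RegInstr R) :
    ∃ T, CounterRational T ∧ Simulates T R := by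
  cases hR with
  | inc i =>
    obtain ⟨T, hT, hTe⟩ := exists_mul (Nat.nth Nat.Prime i)
    refine ⟨T, hT, fun N s h => ⟨fun e he => ?_, ?_⟩⟩
    · exact ⟨_, _, rfl, h.mul i, (hTe _ _).1 he⟩
    · rintro _ rfl
      exact ⟨_, h.mul i, (hTe _ _).2 rfl⟩
  | dec i =>
    obtain ⟨T, hT, hTe⟩ := exists_div (Nat.prime_nth_prime i).pos
    refine ⟨T, hT, fun N s h => ⟨fun e he => ?_, ?_⟩⟩
    · obtain ⟨hd, rfl⟩ := (hTe _ _).1 he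
      have hi := (h.dvd_iff i).1 hd
      exact ⟨_, _, ⟨hi, rfl⟩, h.div hi, rfl⟩
    · rintro _ ⟨hi, rfl⟩
      exact ⟨_, h.div hi, (hTe _ _).2 ⟨(h.dvd_iff i).2 hi, rfl⟩⟩
  | isZero i =>
    obtain ⟨T, hT, hTe⟩ := exists_notDvd (Nat.prime_nth_prime i).pos
    refine ⟨T, hT, fun N s h => ⟨fun e he => ?_, ?_⟩⟩
    · obtain ⟨hd, rfl⟩ := (hTe _ _).1 he
      exact ⟨_, _, ⟨not_not.1 (mt (h.dvd_iff i).2 hd), rfl⟩, h, rfl⟩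
    · rintro _ ⟨hi, rfl⟩
      exact ⟨_, h, (hTe _ _).2 ⟨fun hd => (h.dvd_iff i).1 hd hi, rfl⟩⟩

theorem Simulates.comp {T T' : (Fin 2 → ℕ) → (Fin 2 → ℕ) → Prop}
    {R R' : (ℕ → ℕ) → (ℕ → ℕ) → Prop} (h : Simulates T R) (h' : Simulates T' R') :
    Simulates (Comp T T') (Comp R R') := by
  refine fun N s hs => ⟨?_, ?_⟩
  · rintro e ⟨d, hd, he⟩
    obtain ⟨M, t, ht, hM, rfl⟩ := (h N s hs).1 d hd
    obtain ⟨M', t', ht', hM', rfl⟩ := (h' M t hM).1 e he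
    exact ⟨M', t', ⟨t, ht, ht'⟩, hM', rfl⟩
  · rintro t ⟨u, hu, ht⟩
    obtain ⟨M, hM, hT⟩ := (h N s hs).2 u hu
    obtain ⟨M', hM', hT'⟩ := (h' M u hM).2 t ht
    exact ⟨M', hM', _, hT, hT'⟩

theorem Simulates.star {T : (Fin 2 → ℕ) → (Fin 2 → ℕ) → Prop}
    {R : (ℕ → ℕ) → (ℕ → ℕ) → Prop} (h : Simulates T R) :
    Simulates (ReflTransGen T) (ReflTransGen R) := by
  refine fun N s hs => ⟨fun e he => ?_, fun t ht => ?_⟩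
  · induction he with
    | refl => exact ⟨N, s, .refl, hs, rfl⟩
    | tail _ he ih =>
      obtain ⟨M, t, ht, hM, rfl⟩ := ih
      obtain ⟨M', t', ht', hM', rfl⟩ := (h M t hM).1 _ he
      exact ⟨M', t', ht.tail ht', hM', rfl⟩
  · induction ht with
    | refl => exact ⟨N, hs, .refl⟩
    | tail _ ht ih =>
      obtain ⟨M, hM, hT⟩ := ih
      obtain ⟨M', hM', hT'⟩ := (h M _ hM).2 _ ht
      exact ⟨M', hM', hT.tail hT'⟩

theorem exists_simulates {R : (ℕ → ℕ) → (ℕ → ℕ) → Prop} (hR : RationalRel RegInstr R) :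
    ∃ T, CounterRational T ∧ Simulates T R := by
  induction hR with
  | base h => exact exists_simulates_instr h
  | comp _ _ ih ih' =>
    obtain ⟨T, hT, h⟩ := ih
    obtain ⟨T', hT', h'⟩ := ih'
    exact ⟨_, hT.comp hT', h.comp h'⟩
  | star _ ih =>
    obtain ⟨T, hT, h⟩ := ih
    exact ⟨_, hT.star, h.star⟩

/-- Domains of partial recursive functions are recognized by two-counter machines that start with
`2 ^ n` in the first counter and empty both counters before they halt. -/
theorem exists_counter_halting {f : ℕ →. ℕ} (hf : Nat.Partrec f) :
    ∃ T, CounterRational T ∧ ∀ n e, T ![2 ^ n, 0] e ↔ (f n).Dom ∧ e = 0 := by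
  have hf' : Nat.Partrec' fun v : List.Vector ℕ 1 => f v.head :=
    Nat.Partrec'.of_part (Partrec.comp (Partrec.nat_iff.2 hf) Computable.vector_head)
  -- Register `0` is both input and output; scratch space starts at `1`.
  obtain ⟨R, hR, hRf⟩ := RegComputes.of_partrec' hf' (fun _ => 0) 0 1 (by simp) (by simp)
  obtain ⟨T, hT, hTR⟩ := exists_simulates hR
  -- Trading units for nothing down to remainder `0` empties the first counter, so the final
  -- counters do not reveal the computed value.
  obtain ⟨Z, hZ, hZe⟩ := exists_convert 1 0 0 0
  refine ⟨_, hT.comp hZ, fun n e => ?_⟩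
  -- As `2` is the prime with index `0`, the number `2 ^ n` stores `n` in register `0` and leaves
  -- the others empty.
  have hrep : Represents (2 ^ n) (update (0 : ℕ → ℕ) 0 n) := by
    refine ⟨by positivity, fun i => ?_⟩
    have h2 : 2 = Nat.nth Nat.Prime 0 := Nat.nth_prime_zero_eq_two.symm
    rw [Nat.factorization_pow, h2, Finsupp.smul_apply, factorization_nth_prime, update_apply]
    split_ifs <;> simp
  have hclean : CleanFrom 1 (update (0 : ℕ → ℕ) 0 n) := fun i hi => by
    rw [update_of_ne (by omega)]; rfl
  have hRs (t : ℕ → ℕ) : R (update (0 : ℕ → ℕ) 0 n) t ↔ ∃ y ∈ f n, t = update (update (0 : ℕ → ℕ) 0 n) 0 y := by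
    simpa [← List.Vector.get_zero] using hRf _ hclean t
  have hZe' (M : ℕ) (e : Fin 2 → ℕ) : Z ![M, 0] e ↔ e = 0 := by
    rw [hZe]
    constructor
    · rintro ⟨k, h1, -, h2, rfl⟩
      exact funext (Fin.forall_fin_two.2 ⟨by simpa using h2, rfl⟩)
    · rintro rfl
      exact ⟨M, by simp, by simp, by simp, funext (Fin.forall_fin_two.2 ⟨by simp, rfl⟩)⟩
  rw [Part.dom_iff_mem]
  constructor
  · rintro ⟨d, hd, he⟩
    obtain ⟨M, t, ht, hM, rfl⟩ := (hTR _ _ hrep).1 d hd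
    obtain ⟨y, hy, -⟩ := (hRs t).1 ht
    exact ⟨⟨y, hy⟩, (hZe' _ _).1 he⟩
  · rintro ⟨⟨y, hy⟩, rfl⟩
    obtain ⟨M, hM, hTM⟩ := (hTR _ _ hrep).2 _ ((hRs _).2 ⟨y, hy, rfl⟩)
    exact ⟨_, hTM, (hZe' _ _).2 rfl⟩

/-! ### From rational relations to finite automata -/

/-- Edges of two-counter automata. -/
structure CounterEdge (Q : Type) where
  src : Q
  guard : SimpleConstraint (Fin 1) (Fin 2)
  upd : Fin 2 → ℤ
  tgt : Q

/-- The transitions of the automaton with edges `E` on configurations (location, counters). -/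
def CounterStep {Q : Type} (E : List (CounterEdge Q)) (p q : Q × (Fin 2 → ℕ)) : Prop :=
  ∃ e ∈ E, p.1 = e.src ∧ q.1 = e.tgt ∧ counterRel e.guard e.upd p.2 q.2

theorem counterRel_nil_zero {d e : Fin 2 → ℕ} : counterRel [] 0 d e ↔ e = d := by
  simp [counterRel, SimpleConstraint.Sat, funext_iff]

def CounterEdge.map {Q Q' : Type} (f : Q → Q') (e : CounterEdge Q) : CounterEdge Q' :=
  ⟨f e.src, e.guard, e.upd, f e.tgt⟩

theorem CounterStep.map {Q Q' : Type} (f : Q → Q') {E : List (CounterEdge Q)}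
    {E' : List (CounterEdge Q')} (hE : ∀ e ∈ E, e.map f ∈ E') {p q : Q × (Fin 2 → ℕ)}
    (h : ReflTransGen (CounterStep E) p q) :
    ReflTransGen (CounterStep E') (f p.1, p.2) (f q.1, q.2) := by
  refine h.lift (fun p : Q × (Fin 2 → ℕ) => (f p.1, p.2)) ?_
  rintro a b ⟨e, he, h1, h2, h3⟩
  exact ⟨e.map f, hE e he, congrArg f h1, congrArg f h2, h3⟩

theorem CounterStep.silent {Q : Type} {E : List (CounterEdge Q)} {p q : Q} {d : Fin 2 → ℕ}
    (h : ⟨p, [], 0, q⟩ ∈ E) : CounterStep E (p, d) (q, d) :=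
  ⟨_, h, rfl, rfl, counterRel_nil_zero.2 rfl⟩

/-- Every rational relation on two counters is the relation between entry and exit of a finite
two-counter automaton. -/
theorem exists_counterAutomaton {T : (Fin 2 → ℕ) → (Fin 2 → ℕ) → Prop} (hT : CounterRational T) :
    ∃ (Q : Type) (_ : Finite Q) (E : List (CounterEdge Q)) (a b : Q),
      ∀ d e, ReflTransGen (CounterStep E) (a, d) (b, e) ↔ T d e := by
  induction hT with
  | base h =>
    obtain ⟨g, u⟩ := h
    refine ⟨Bool, inferInstance, [⟨false, g, u, true⟩], false, true, fun d e => ⟨fun h => ?_,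
      fun h => .single ⟨_, List.mem_singleton_self _, rfl, rfl, h⟩⟩⟩
    have key (p : Bool × (Fin 2 → ℕ))
        (hp : ReflTransGen (CounterStep [⟨false, g, u, true⟩]) (false, d) p) :
        (p.1 = false → p.2 = d) ∧ (p.1 = true → counterRel g u d p.2) := by
      induction hp with
      | refl => simp
      | tail _ h ih =>
        obtain ⟨e, he, h1, h2, h3⟩ := h
        rw [List.mem_singleton] at he
        subst he
        rw [h2]
        exact ⟨by simp, fun _ => ih.1 h1 ▸ h3⟩
    exact (key _ h).2 rfl
  | @comp R S _ _ ih ih' =>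
    obtain ⟨Q, _, E, a, b, h⟩ := ih
    obtain ⟨Q', _, E', a', b', h'⟩ := ih'
    let F : List (CounterEdge (Q ⊕ Q')) :=
      ⟨.inl b, [], 0, .inr a'⟩ :: (E.map (.map .inl) ++ E'.map (.map .inr))
    refine ⟨Q ⊕ Q', inferInstance, F, .inl a, .inr b', fun d e => ⟨fun hde => ?_, ?_⟩⟩
    -- No edge leads back from the right copy, so a run that has reached it splits at the single
    -- crossing, where the counters are `z`.
    · have key (p : (Q ⊕ Q') × (Fin 2 → ℕ)) (hp : ReflTransGen (CounterStep F) (.inl a, d) p) :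
          (∀ q, p.1 = .inl q → ReflTransGen (CounterStep E) (a, d) (q, p.2)) ∧
          (∀ q, p.1 = .inr q → ∃ z, R d z ∧ ReflTransGen (CounterStep E') (a', z) (q, p.2)) := by
        induction hp with
        | refl => simp [ReflTransGen.refl]
        | @tail p p' _ hs ih =>
          obtain ⟨c, hc, h1, h2, h3⟩ := hs
          rw [List.mem_cons, List.mem_append, List.mem_map, List.mem_map] at hc
          rcases hc with rfl | ⟨c, hc, rfl⟩ | ⟨c, hc, rfl⟩
          · refine ⟨by simp [h2], fun q hq => ?_⟩
            rw [h2] at hq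
            obtain rfl := Sum.inr_injective hq
            rw [counterRel_nil_zero.1 h3]
            exact ⟨p.2, (h _ _).1 (ih.1 b h1), .refl⟩
          · refine ⟨fun q hq => ?_, by simp [h2, CounterEdge.map]⟩
            obtain rfl : c.tgt = q := Sum.inl_injective (h2.symm.trans hq)
            exact (ih.1 c.src h1).tail ⟨c, hc, rfl, rfl, h3⟩
          · refine ⟨by simp [h2, CounterEdge.map], fun q hq => ?_⟩
            obtain rfl : c.tgt = q := Sum.inr_injective (h2.symm.trans hq)
            obtain ⟨z, hz, hz'⟩ := ih.2 c.src h1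
            exact ⟨z, hz, hz'.tail ⟨c, hc, rfl, rfl, h3⟩⟩
      obtain ⟨z, hz, hz'⟩ := (key _ hde).2 b' rfl
      exact ⟨z, hz, (h' _ _).1 hz'⟩
    · rintro ⟨z, hz, hz'⟩
      refine ((CounterStep.map Sum.inl ?_ ((h _ _).2 hz)).tail
        (CounterStep.silent (by simp [F]))).trans (CounterStep.map Sum.inr ?_ ((h' _ _).2 hz'))
      · exact fun c hc => List.mem_cons_of_mem _
          (List.mem_append_left _ (List.mem_map_of_mem hc))
      · exact fun c hc => List.mem_cons_of_mem _
          (List.mem_append_right _ (List.mem_map_of_mem hc))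
  | @star R _ ih =>
    obtain ⟨Q, _, E, a, b, h⟩ := ih
    -- The fresh location `none` is entry and exit, which accepts zero rounds. Being there means
    -- that a whole number of rounds is complete, even if edges of `E` enter `a` or leave `b`.
    let F : List (CounterEdge (Option Q)) :=
      ⟨none, [], 0, some a⟩ :: ⟨some b, [], 0, none⟩ :: E.map (.map some)
    refine ⟨Option Q, inferInstance, F, none, none, fun d e => ⟨fun hde => ?_, fun hde => ?_⟩⟩
    · have key (p : Option Q × (Fin 2 → ℕ)) (hp : ReflTransGen (CounterStep F) (none, d) p) :
          (p.1 = none → ReflTransGen R d p.2) ∧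
          (∀ q, p.1 = some q → ∃ z, ReflTransGen R d z ∧
            ReflTransGen (CounterStep E) (a, z) (q, p.2)) := by
        induction hp with
        | refl => simp [ReflTransGen.refl]
        | @tail p p' _ hs ih =>
          obtain ⟨c, hc, h1, h2, h3⟩ := hs
          rw [List.mem_cons, List.mem_cons, List.mem_map] at hc
          rcases hc with rfl | rfl | ⟨c, hc, rfl⟩
          · refine ⟨by simp [h2], fun q hq => ?_⟩
            rw [h2] at hq
            obtain rfl := Option.some_injective _ hq
            rw [counterRel_nil_zero.1 h3]
            exact ⟨p.2, ih.1 h1, .refl⟩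
          · refine ⟨fun _ => ?_, by simp [h2]⟩
            rw [counterRel_nil_zero.1 h3]
            obtain ⟨z, hz, hz'⟩ := ih.2 b h1
            exact hz.tail ((h _ _).1 hz')
          · refine ⟨by simp [h2, CounterEdge.map], fun q hq => ?_⟩
            obtain rfl : c.tgt = q := Option.some_injective _ (h2.symm.trans hq)
            obtain ⟨z, hz, hz'⟩ := ih.2 c.src h1
            exact ⟨z, hz, hz'.tail ⟨c, hc, rfl, rfl, h3⟩⟩
      exact (key _ hde).1 rfl
    · induction hde with
      | refl => exact .refl
      | tail _ hs ih =>
        refine ih.trans (((ReflTransGen.single (CounterStep.silent (q := some a) ?_)).trans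
          (CounterStep.map some ?_ ((h _ _).2 hs))).tail (CounterStep.silent ?_))
        · simp [F]
        · exact fun c hc => List.mem_cons_of_mem _
            (List.mem_cons_of_mem _ (List.mem_map_of_mem hc))
        · simp [F]

/-! ### Two-counter automata as discrete guarded METAs -/

def CounterEdge.toMETAEdge {L : Type} (e : CounterEdge L) : METAEdge (Fin 0) L (Fin 1) (Fin 2) :=
  ⟨e.src, e.guard, none, ∅, e.upd, e.tgt⟩

/-- The discrete guarded META with the edges of a two-counter automaton, one private location `p`
and one final location `f`. Its invariants do not let time elapse. -/
def counterMETA {L : Type} (i p f : L) (E : List (CounterEdge L)) (hpf : f ≠ p)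
    (hf : ∀ e ∈ E, e.src ≠ f) : GuardedMETA (Fin 0) L ℕ (Fin 1) (Fin 2) where
  init := i
  priv := {p}
  final := {f}
  label := fun _ => ∅
  inv := fun _ => [⟨.inl 0, .le, 0⟩]
  rate := fun _ _ => 0
  edges := E.map CounterEdge.toMETAEdge
  priv_nonempty := Finset.singleton_nonempty p
  final_nonempty := Finset.singleton_nonempty f
  final_not_priv := by simpa using hpf
  final_no_outgoing := by simpa [CounterEdge.toMETAEdge] using hf
  init_inv := by simp [SimpleConstraint.Sat, Cmp.Holds]

/-- The state with all clocks `0` and the energies given by two counters. -/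
def counterState {L : Type} (l : L) (d : Fin 2 → ℕ) : METAState L (Fin 1) (Fin 2) :=
  ⟨l, fun _ => 0, fun η => (d η : ℝ)⟩

theorem GuardedMETA.Run.visits_of_mem {Act Loc AP Clk En : Type}
    {A : GuardedMETA Act Loc AP Clk En} {s : METAState Loc Clk En} (r : A.Run s) {S : Finset Loc}
    (h : s.loc ∈ S) : r.Visits S := by
  cases r with
  | start => exact h
  | step r d e hs => exact .inr h

section counterMETA

variable {L : Type} {i p f : L} {E : List (CounterEdge L)} {hpf : f ≠ p}
  {hf : ∀ e ∈ E, e.src ≠ f}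

theorem counterMETA_isState {s : METAState L (Fin 1) (Fin 2)} :
    (counterMETA i p f E hpf hf).IsState s ↔ s.clk = 0 ∧ ∀ η, 0 ≤ s.en η := by
  simp only [GuardedMETA.IsState, counterMETA, SimpleConstraint.Sat, Cmp.Holds, funext_iff,
    Fin.forall_fin_one, List.mem_singleton, forall_eq, Sum.elim_inl, Int.cast_zero, Pi.zero_apply]
  exact ⟨fun h => ⟨le_antisymm h.2.2 h.1, h.2.1⟩, fun h => ⟨h.1.ge, h.2, h.1.le⟩⟩

theorem counterMETA_initState :
    (counterMETA i p f E hpf hf).initState = counterState i 0 := by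
  simp [GuardedMETA.initState, counterState, counterMETA]

/-- The invariant together with non-negative clocks forces the delay to be `0`. Integer offsets and
non-negative energies keep the energies natural, so the automaton has no behaviour beyond that of
the counters. -/
theorem counterMETA_step_iff {l : L} {d : Fin 2 → ℕ} {δ : ℝ} {t : METAState L (Fin 1) (Fin 2)} :
    (∃ e, (counterMETA i p f E hpf hf).Step (counterState l d) δ e t) ↔
      δ = 0 ∧ ∃ l' d', t = counterState l' d' ∧ CounterStep E (l, d) (l', d') := by
  constructor
  · rintro ⟨_, s', ⟨hδ, rfl, hst⟩, -, ht, he, h1, h2, h3, h4, h5⟩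
    have h0 : δ = 0 := by
      have := congrFun (counterMETA_isState.1 (hst δ hδ le_rfl)).1 0
      simpa [GuardedMETA.elapse, counterState] using this
    subst h0
    obtain ⟨e, heE, rfl⟩ := List.mem_map.1 he
    obtain ⟨htc, htn⟩ := counterMETA_isState.1 ht
    have hen (η : Fin 2) : t.en η = (((d η : ℤ) + e.upd η : ℤ) : ℝ) := by
      simpa [GuardedMETA.elapse, counterState, CounterEdge.toMETAEdge] using h4 η
    have hnn (η : Fin 2) : 0 ≤ (d η : ℤ) + e.upd η := by
      have := htn η
      rw [hen] at this
      exact_mod_cast this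
    refine ⟨rfl, e.tgt, fun η => ((d η : ℤ) + e.upd η).toNat, ?_, e, heE, h1, rfl, ?_, fun η =>
      Int.toNat_of_nonneg (hnn η)⟩
    · obtain ⟨tl, tc, te⟩ := t
      simp only [counterState, METAState.mk.injEq]
      refine ⟨h2, htc, funext fun η => (hen η).trans ?_⟩
      exact_mod_cast congrArg (Int.cast (R := ℝ)) (Int.toNat_of_nonneg (hnn η)).symm
    · simpa [GuardedMETA.elapse, counterState] using! h5
  · rintro ⟨rfl, l', d', rfl, e, he, h1, h2, h3, h4⟩
    have hel : (counterMETA i p f E hpf hf).elapse (counterState l d) 0 = counterState l d := by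
      simp [GuardedMETA.elapse, counterState]
    have hst (l : L) (d : Fin 2 → ℕ) :
        (counterMETA i p f E hpf hf).IsState (counterState l d) :=
      counterMETA_isState.2 ⟨rfl, fun η => Nat.cast_nonneg _⟩
    refine ⟨e.toMETAEdge, counterState l d, ⟨le_rfl, hel.symm, fun δ h h' => ?_⟩, hst _ _, hst _ _,
      List.mem_map_of_mem he, h1, h2, fun x => ⟨fun _ => rfl, fun _ => rfl⟩, fun η => ?_, h3⟩
    · rw [le_antisymm h' h, hel]
      exact hst _ _
    · have := h4 η
      simp only [counterState, CounterEdge.toMETAEdge]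
      exact_mod_cast this

theorem exists_run_step {l l' : L} {d d' : Fin 2 → ℕ}
    (r : (counterMETA i p f E hpf hf).Run (counterState l d)) (h : CounterStep E (l, d) (l', d')) :
    ∃ r' : (counterMETA i p f E hpf hf).Run (counterState l' d'),
      (r'.Visits {p} ↔ r.Visits {p} ∨ l' = p) ∧ r'.duration = r.duration := by
  obtain ⟨e, he⟩ := (counterMETA_step_iff (hpf := hpf) (hf := hf) (i := i)).2 ⟨rfl, l', d', rfl, h⟩
  exact ⟨.step r 0 e he, by simp [GuardedMETA.Run.Visits, counterState],
    by simp [GuardedMETA.Run.duration]⟩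

theorem exists_run_start : ∃ r : (counterMETA i p f E hpf hf).Run (counterState i 0),
    (r.Visits {p} ↔ i = p) ∧ r.duration = 0 := by
  rw [← counterMETA_initState (p := p) (f := f) (E := E) (hpf := hpf) (hf := hf)]
  exact ⟨.start, by simp [GuardedMETA.Run.Visits, counterMETA], rfl⟩

end counterMETA

/-! ### Private and public branches around the automaton -/

/-- The edges that connect a two-counter automaton with edges `E`, entry `a` and exit `b` to an
initial location `i`, a private location `p` and a final location `f`, where the initial location
leads to the entry with offset `c` in the first counter. -/
def hubEdges {Q L : Type} (j : Q → L) (i p f : L) (E : List (CounterEdge Q)) (a b : Q) (c : ℕ) :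
    List (CounterEdge L) :=
  ⟨i, [], ![(c : ℤ), 0], j a⟩ :: ⟨i, [], 0, p⟩ :: ⟨p, [], 0, f⟩ :: ⟨j b, [], 0, f⟩ ::
    E.map (.map j)

theorem hubEdges_src {Q L : Type} {j : Q → L} {i p f : L} (hif : i ≠ f) (hpf : f ≠ p)
    (hjf : ∀ q, j q ≠ f) (E : List (CounterEdge Q)) (a b : Q) (c : ℕ) :
    ∀ e ∈ hubEdges j i p f E a b c, e.src ≠ f := by
  simp [hubEdges, hif, hpf.symm, hjf, CounterEdge.map]

section hub

variable {Q L : Type} {j : Q → L} {i p f : L} {E : List (CounterEdge Q)} {a b : Q} {c : ℕ}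
  {D : Prop} {hpf : f ≠ p} {hf : ∀ e ∈ hubEdges j i p f E a b c, e.src ≠ f}

/-- This is the invariant of all runs. The final location is entered either from `p`, which makes
the run private, or from the exit of the automaton, which requires `D`; both ways the counters are
empty. -/
theorem hub_run (hj : Injective j) (hif : i ≠ f) (hji : ∀ q, j q ≠ i)
    (hjp : ∀ q, j q ≠ p) (hjf : ∀ q, j q ≠ f)
    (hE : ∀ e, ReflTransGen (CounterStep E) (a, ![c, 0]) (b, e) ↔ D ∧ e = 0)
    {s : METAState L (Fin 1) (Fin 2)}
    (r : (counterMETA i p f (hubEdges j i p f E a b c) hpf hf).Run s) :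
    r.duration = 0 ∧ ∃ l d, s = counterState l d ∧ (l = i → d = 0) ∧ (l = p → d = 0) ∧
      (∀ q, l = j q → ReflTransGen (CounterStep E) (a, ![c, 0]) (q, d)) ∧
      (l = f → d = 0 ∧ (r.Visits {p} ∨ D)) := by
  induction r with
  | start =>
    exact ⟨rfl, i, 0, counterMETA_initState, by simp, by simp, fun q h => absurd h.symm (hji q),
      fun h => absurd h hif⟩
  | @step s t r δ e hs ih =>
    obtain ⟨hr, l, d, rfl, hi, hp, hq, -⟩ := ih
    obtain ⟨rfl, l', d', rfl, c', hc', h1, h2, h3⟩ := counterMETA_step_iff.1 ⟨e, hs⟩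
    refine ⟨by simp [GuardedMETA.Run.duration, hr], l', d', rfl, ?_⟩
    dsimp only at h1 h2 h3
    subst h1 h2
    simp only [hubEdges, List.mem_cons, List.mem_map] at hc'
    rcases hc' with rfl | rfl | rfl | rfl | ⟨e', he', rfl⟩
    · refine ⟨fun h => absurd h (hji a), fun h => absurd h (hjp a), fun q h => ?_,
        fun h => absurd h (hjf a)⟩
      obtain rfl := hj h
      rw [hi rfl, counterRel_add] at h3
      rw [show d' = ![c, 0] from eq_vec_iff.2 (by simpa using h3)]
    · have := (counterRel_nil_zero.1 h3).trans (hi rfl)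
      exact ⟨fun _ => this, fun _ => this, fun q h => absurd h.symm (hjp q),
        fun h => absurd h hpf.symm⟩
    · have := (counterRel_nil_zero.1 h3).trans (hp rfl)
      exact ⟨fun _ => this, fun _ => this, fun q h => absurd h.symm (hjf q),
        fun _ => ⟨this, .inl (.inl (r.visits_of_mem (by simp [counterState])))⟩⟩
    · obtain ⟨hD, h0⟩ := (hE d).1 (hq b rfl)
      have := (counterRel_nil_zero.1 h3).trans h0
      exact ⟨fun _ => this, fun _ => this, fun q h => absurd h.symm (hjf q),
        fun _ => ⟨this, .inr hD⟩⟩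
    · refine ⟨fun h => absurd h (hji _), fun h => absurd h (hjp _), fun q h => ?_,
        fun h => absurd h (hjf _)⟩
      obtain rfl := hj h
      exact (hq e'.src rfl).tail ⟨e', he', rfl, rfl, h3⟩

/-- The path from `i` through `p` to `f` bypasses the automaton, so this observation is present
whether or not `D` holds. -/
theorem hub_private_run :
    ∃ r : (counterMETA i p f (hubEdges j i p f E a b c) hpf hf).Run (counterState f 0),
      r.IsPrivate ∧ r.duration = 0 := by
  obtain ⟨r, -, hr⟩ := exists_run_start (i := i) (hpf := hpf) (hf := hf)
  obtain ⟨r', hr', hd'⟩ := exists_run_step r (l' := p) (d' := 0)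
    (CounterStep.silent (by simp [hubEdges]))
  obtain ⟨r'', hr'', hd''⟩ := exists_run_step r' (l' := f) (d' := 0)
    (CounterStep.silent (by simp [hubEdges]))
  exact ⟨r'', ⟨by simp [counterMETA, counterState], hr''.2 (.inl (hr'.2 (.inr rfl)))⟩,
    by rw [hd'', hd', hr]⟩

theorem hub_public_run (hip : i ≠ p) (hjp : ∀ q, j q ≠ p)
    (hE : ReflTransGen (CounterStep E) (a, ![c, 0]) (b, 0)) :
    ∃ r : (counterMETA i p f (hubEdges j i p f E a b c) hpf hf).Run (counterState f 0),
      r.IsPublic ∧ r.duration = 0 := by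
  have key (x : Q × (Fin 2 → ℕ)) (hx : ReflTransGen (CounterStep E) (a, ![c, 0]) x) :
      ∃ r : (counterMETA i p f (hubEdges j i p f E a b c) hpf hf).Run (counterState (j x.1) x.2),
        ¬ r.Visits {p} ∧ r.duration = 0 := by
    induction hx with
    | refl =>
      obtain ⟨r, hv, hr⟩ := exists_run_start (i := i) (hpf := hpf) (hf := hf)
      obtain ⟨r', hr', hd'⟩ := exists_run_step r (l' := j a) (d' := ![c, 0])
        ⟨_, List.mem_cons_self, rfl, rfl, counterRel_add.2 (by simp)⟩
      exact ⟨r', by simp [hr', hv, hip, hjp], by rw [hd', hr]⟩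
    | @tail y z _ hyz ih =>
      obtain ⟨r, hv, hr⟩ := ih
      obtain ⟨e, he, h1, h2, h3⟩ := hyz
      obtain ⟨r', hr', hd'⟩ := exists_run_step r (l' := j z.1) (d' := z.2)
        ⟨e.map j, List.mem_append_right [_, _, _, _] (List.mem_map_of_mem he), congrArg j h1,
          congrArg j h2, h3⟩
      exact ⟨r', by simp [hr', hv, hjp], by rw [hd', hr]⟩
  obtain ⟨r, hv, hr⟩ := key _ hE
  obtain ⟨r', hr', hd'⟩ := exists_run_step r (l' := f) (d' := 0)
    (CounterStep.silent (by simp [hubEdges]))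
  exact ⟨r', ⟨by simp [counterMETA, counterState], fun h => by
    rcases hr'.1 h with h | h
    exacts [hv h, hpf h]⟩, by rw [hd', hr]⟩

/-- If the public set is either empty or the same singleton as the private one, meeting, inclusion
and equality coincide. This lets one reduction serve all three notions. -/
theorem opacityKind_rel_singleton {α : Type} (δ : OpacityKind) (x : α) :
    δ.Rel {x} {y | y = x ∧ D} ↔ D := by
  cases δ <;> simp [OpacityKind.Rel, Set.Nonempty, Set.ext_iff]

theorem hub_opaque_iff (hj : Injective j) (hip : i ≠ p) (hif : i ≠ f) (hji : ∀ q, j q ≠ i)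
    (hjp : ∀ q, j q ≠ p) (hjf : ∀ q, j q ≠ f)
    (hE : ∀ e, ReflTransGen (CounterStep E) (a, ![c, 0]) (b, e) ↔ D ∧ e = 0)
    (δ : OpacityKind) (σ : Observation) :
    (counterMETA i p f (hubEdges j i p f E a b c) hpf hf).Opaque δ σ ↔ D := by
  have hzero : (counterState f 0).en = 0 := by simp [counterState]; rfl
  have hend {s : METAState L (Fin 1) (Fin 2)}
      (r : (counterMETA i p f (hubEdges j i p f E a b c) hpf hf).Run s)
      (hs : s.loc ∈ (counterMETA i p f (hubEdges j i p f E a b c) hpf hf).final) :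
      r.duration = 0 ∧ s.en = 0 ∧ (r.Visits {p} ∨ D) := by
    obtain ⟨hr, l, d, rfl, -, -, -, h⟩ := hub_run hj hif hji hjp hjf hE r
    obtain ⟨rfl, hv⟩ := h (by simpa [counterMETA, counterState] using hs)
    exact ⟨hr, by simp [counterState]; rfl, hv⟩
  obtain ⟨r, hr, hd⟩ := hub_private_run (j := j) (E := E) (a := a) (b := b) (c := c)
    (hpf := hpf) (hf := hf)
  have hpub (hD : D) := hub_public_run (hpf := hpf) (hf := hf) hip hjp ((hE 0).2 ⟨hD, rfl⟩)
  cases σ with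
  | EN =>
    refine Iff.trans (iff_of_eq (congrArg₂ δ.Rel ?_ ?_)) (opacityKind_rel_singleton δ 0)
    · ext v
      constructor
      · rintro ⟨s, r, hr, rfl⟩
        exact (hend r hr.1).2.1
      · rintro rfl
        exact ⟨_, r, hr, hzero⟩
    · ext v
      constructor
      · rintro ⟨s, r, hr, rfl⟩
        obtain ⟨-, h1, h2⟩ := hend r hr.1
        exact ⟨h1, h2.resolve_left hr.2⟩
      · rintro ⟨rfl, hD⟩
        obtain ⟨r, hr, -⟩ := hpub hD
        exact ⟨_, r, hr, hzero⟩
  | ETEN =>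
    refine Iff.trans (iff_of_eq (congrArg₂ δ.Rel ?_ ?_)) (opacityKind_rel_singleton δ (0, 0))
    · ext v
      constructor
      · rintro ⟨s, r, hr, h1, h2⟩
        obtain ⟨h3, h4, -⟩ := hend r hr.1
        exact Prod.ext (h1.symm.trans h3) (h2.symm.trans h4)
      · rintro rfl
        exact ⟨_, r, hr, hd, hzero⟩
    · ext v
      constructor
      · rintro ⟨s, r, hr, h1, h2⟩
        obtain ⟨h3, h4, h5⟩ := hend r hr.1
        exact ⟨Prod.ext (h1.symm.trans h3) (h2.symm.trans h4), h5.resolve_left hr.2⟩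
      · rintro ⟨rfl, hD⟩
        obtain ⟨r, hr, hd⟩ := hpub hD
        exact ⟨_, r, hr, hd, hzero⟩

end hub

/-! ### Computability of the reduction and undecidability -/

theorem primrec_intCast : Primrec fun n : ℕ => (n : ℤ) := by
  refine Primrec.encode_iff.1 ?_
  -- The encoding of the integers sends the non-negative ones to the even numbers.
  have (n : ℕ) : Encodable.encode (n : ℤ) = 2 * n := rfl
  simp only [this]
  exact Primrec.nat_mul.comp (.const 2) .id

theorem primrec_two_pow : Primrec fun n : ℕ => 2 ^ n := by
  refine (Primrec.nat_rec₁ (f := fun _ x => 2 * x) 1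
    (Primrec.nat_mul.comp (.const 2) .snd)).of_eq fun n => ?_
  induction n with
  | zero => rfl
  | succ n ih => rw [pow_succ', ← ih]

/-- All entries of the description are constant except one offset of the first edge, which is `2 ^
n`. -/
theorem computable_hub_code {Q : Type} {N : ℕ} (j : Q → Fin N) (i p f : Fin N)
    (E : List (CounterEdge Q)) (a b : Q) (hpf : f ≠ p)
    (hf : ∀ c, ∀ e ∈ hubEdges j i p f E a b c, e.src ≠ f) :
    Computable fun n : ℕ =>
      (counterMETA i p f (hubEdges j i p f E a b (2 ^ n)) hpf (hf _)).code := by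
  refine Primrec.to_comp ?_
  simp only [GuardedMETA.code, counterMETA, hubEdges, List.map_cons, METAEdge.code,
    CounterEdge.toMETAEdge]
  refine .pair (.const _) <| .pair (.const _) <| .pair (.const _) <| .pair (.const _) <|
    .pair (.const _) <| .pair (.const _) <| .pair (.const _) <| .pair (.const _) <|
    .pair (.const _) <| .pair (.const _) <| Primrec.list_cons.comp ?_ (.const _)
  refine .pair (.const _) <| .pair (.const _) <| .pair (.const _) <| .pair (.const _) <|
    .pair ?_ (.const _)
  simp only [List.ofFn_succ, List.ofFn_zero]
  exact Primrec.list_cons.comp (primrec_intCast.comp primrec_two_pow) (.const [0])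

theorem mainTheorem2 (δ : OpacityKind) (σ : Observation) :
    ¬ DecidableOnMETAs
        (fun _ _ x m A => A.IsDiscrete ∧ m = 2 ∧ x = 1)
        (fun _ _ _ _ A => A.Opaque δ σ) := by
  rintro ⟨dec, hdec, hspec⟩
  -- Using the universal function makes the automaton independent of the program, whose number
  -- enters only as `n`.
  let h : ℕ →. ℕ := fun n => (Denumerable.ofNat Nat.Partrec.Code n).eval 0
  have hh : Nat.Partrec h := Partrec.nat_iff.1
    (Nat.Partrec.Code.eval_part.comp (Computable.ofNat _) (.const 0))
  obtain ⟨T, hT, hTh⟩ := exists_counter_halting hh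
  obtain ⟨Q, _, E, a, b, hE⟩ := exists_counterAutomaton hT
  obtain ⟨N, ⟨ι⟩⟩ := Finite.exists_equiv_fin (Q ⊕ Fin 3)
  let j : Q → Fin N := fun q => ι (.inl q)
  let i := ι (.inr 0)
  let p := ι (.inr 1)
  let f := ι (.inr 2)
  have hif : i ≠ f := ι.injective.ne (by simp)
  have hpf : f ≠ p := ι.injective.ne (by simp)
  have hjf (q : Q) : j q ≠ f := ι.injective.ne (by simp)
  have hf := hubEdges_src hif hpf hjf E a b
  let A (n : ℕ) := counterMETA i p f (hubEdges j i p f E a b (2 ^ n)) hpf (hf _)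
  have hA (n : ℕ) : (A n).Opaque δ σ ↔ (h n).Dom :=
    hub_opaque_iff (ι.injective.comp Sum.inl_injective) (ι.injective.ne (by simp)) hif
      (fun q => ι.injective.ne (by simp)) (fun q => ι.injective.ne (by simp)) hjf
      (fun e => (hE _ _).trans (hTh n e)) δ σ
  have hcode : Computable fun n => (A n).code := computable_hub_code j i p f E a b hpf hf
  -- The supposed algorithm is partial, but it halts on every `A n`; so its composition with the
  -- reduction is total and `ans` is computable.
  choose ans hmem hans using fun n => hspec (A n) ⟨fun _ _ => rfl, rfl, rfl⟩
  have hans_comp : Computable ans :=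
    Partrec.of_eq_tot (hdec.comp hcode) hmem
  refine ComputablePred.halting_problem 0 (ComputablePred.computable_iff.2
    ⟨fun c => ans (Encodable.encode c), hans_comp.comp Computable.encode, ?_⟩)
  funext c
  refine propext ?_
  have := (hans (Encodable.encode c)).trans (hA _)
  simpa [h] using this.symm
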